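/- Let $G$ be a discrete group and let $X$ be a minimal $G$-space, i.e. a non-empty compact Hausdorff space on which $G$ acts by homeomorphisms such that the orbit of every point is dense. Let $\beta G$ be the Stone–Čech compactification of $G$, with the associative product for which, for each $\omega\in\beta G$, the map $u\mapsto u\cdot\omega$ is the continuous extension of $g\mapsto g\cdot\omega$, and let $L$ be a minimal left ideal of $\beta G$, on which $G$ acts by left multiplication. The group $G$ acts on $C(X)$ and on $C(L)$ by $(g\cdot f)(x)=f(g^{-1}\cdot x)$. Consider the category of $G$-operator systems (self-adjoint subspaces, containing the unit, of unital $C^*$-algebras, on which $G$ acts by unital complete order isomorphisms) and $G$-equivariant unital completely positive maps. In this category a $G$-injective envelope $I_G(V)$ of $V$ is an object $E$ together with a $G$-equivariant unital complete order embedding $\kappa:V\to E$ that is - $G$-injective: every morphism into $E$ extends along every $G$-equivariant unital complete order embedding; - $G$-essential: a morphism $\varphi$ out of $E$ is a complete order embedding whenever $\varphi\circ\kappa$ is one; - $G$-rigid: the only morphism $\varphi:E\to E$ with $\varphi\circ\kappa=\kappa$ is the identity. Then $C(X)$ has a $G$-injective envelope, and every $G$-injective envelope $I_G(C(X))$ of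 $C(X)$ is a unital $C^*$-algebra with an action of $G$ by $*$-automorphisms (that is, it is isomorphic to such a $C^*$-algebra by a $G$-equivariant unital complete order isomorphism), and for this $C^*$-algebra structure there exists a $G$-equivariant unital $*$-monomorphism of $I_G(C(X))$ into $C(L)$. -/

import Mathlib

universe u

noncomputable section

/-! ### Operator systems and their matrix orders -/

/-- An operator system: a self-adjoint linear subspace, containing the unit, of a unital
C*-algebra. -/
structure OperatorSystem where
  /-- the ambient unital C*-algebra -/
  Alg : Type u
  [cstar : CStarAlgebra Alg]
  /-- the underlying subspace -/
  carrier : Submodule ℂ Alg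
  one_mem : (1 : Alg) ∈ carrier
  star_mem : ∀ a ∈ carrier, star a ∈ carrier

attribute [instance] OperatorSystem.cstar

namespace OperatorSystem

/-- The unit of an operator system. -/
def unit (S : OperatorSystem.{u}) : S.carrier := ⟨1, S.one_mem⟩

/-- The positive cone of `M_n(S)`: those matrices over `S` which are positive elements of the
C*-algebra `M_n(A)`, where `A` is the ambient C*-algebra (an element of a C*-algebra is positive
iff it is of the form `b* b`). -/
def MatrixPos (S : OperatorSystem.{u}) {n : ℕ} (M : Matrix (Fin n) (Fin n) S.carrier) : Prop :=
  ∃ N : CStarMatrix (Fin n) (Fin n) S.Alg,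
    CStarMatrix.ofMatrix (M.map fun v => (v : S.Alg)) = star N * N

/-- Unital completely positive maps. -/
def IsUCP {S T : OperatorSystem.{u}} (f : S.carrier →ₗ[ℂ] T.carrier) : Prop :=
  f S.unit = T.unit ∧
    ∀ (n : ℕ) (M : Matrix (Fin n) (Fin n) S.carrier), S.MatrixPos M → T.MatrixPos (M.map f)

/-- Unital complete order embeddings, i.e. unital maps which are complete order isomorphisms onto
their range. -/
def IsCompleteOrderEmbedding {S T : OperatorSystem.{u}} (f : S.carrier →ₗ[ℂ] T.carrier) : Prop :=
  f S.unit = T.unit ∧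
    ∀ (n : ℕ) (M : Matrix (Fin n) (Fin n) S.carrier), S.MatrixPos M ↔ T.MatrixPos (M.map f)

end OperatorSystem

/-! ### Operator systems with a group action -/

/-- A `G`-operator system: an operator system on which the (discrete) group `G` acts by unital
complete order isomorphisms. (Every `ρ g` is unital completely positive, and so is its inverse
`ρ g⁻¹`.) -/
structure GOperatorSystem (G : Type u) [Group G] extends OperatorSystem.{u} where
  /-- the action -/
  ρ : G →* (carrier →ₗ[ℂ] carrier)
  ρ_ucp : ∀ g, OperatorSystem.IsUCP (S := toOperatorSystem) (T := toOperatorSystem) (ρ g)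

namespace GOperatorSystem

variable {G : Type u} [Group G]

/-- The morphisms: `G`-equivariant unital completely positive maps. -/
def IsGMorphism (S T : GOperatorSystem G) (f : S.carrier →ₗ[ℂ] T.carrier) : Prop :=
  OperatorSystem.IsUCP (S := S.toOperatorSystem) (T := T.toOperatorSystem) f ∧
    ∀ g v, f (S.ρ g v) = T.ρ g (f v)

/-- `G`-equivariant unital complete order embeddings. -/
def IsGEmbedding (S T : GOperatorSystem G) (f : S.carrier →ₗ[ℂ] T.carrier) : Prop :=
  OperatorSystem.IsCompleteOrderEmbedding
      (S := S.toOperatorSystem) (T := T.toOperatorSystem) f ∧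
    ∀ g v, f (S.ρ g v) = T.ρ g (f v)

/-- `E` is `G`-injective: every morphism `V → E` extends along every embedding `j : V → W`. -/
def IsGInjective (E : GOperatorSystem G) : Prop :=
  ∀ (V W : GOperatorSystem G) (j : V.carrier →ₗ[ℂ] W.carrier) (φ : V.carrier →ₗ[ℂ] E.carrier),
    IsGEmbedding V W j → IsGMorphism V E φ →
      ∃ ψ : W.carrier →ₗ[ℂ] E.carrier, IsGMorphism W E ψ ∧ ψ ∘ₗ j = φ

/-- The extension `κ : V → E` is `G`-essential: a morphism out of `E` is an embedding as soon as
its restriction to `V` is. -/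
def IsGEssential (V E : GOperatorSystem G) (κ : V.carrier →ₗ[ℂ] E.carrier) : Prop :=
  ∀ (Z : GOperatorSystem G) (φ : E.carrier →ₗ[ℂ] Z.carrier),
    IsGMorphism E Z φ → IsGEmbedding V Z (φ ∘ₗ κ) → IsGEmbedding E Z φ

/-- The extension `κ : V → E` is `G`-rigid: the identity is the only endomorphism of `E` which
fixes `V`. -/
def IsGRigid (V E : GOperatorSystem G) (κ : V.carrier →ₗ[ℂ] E.carrier) : Prop :=
  ∀ φ : E.carrier →ₗ[ℂ] E.carrier, IsGMorphism E E φ → φ ∘ₗ κ = κ → φ = LinearMap.id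

/-- `(E, κ)` is a `G`-injective envelope of `V`: a `G`-injective, `G`-essential and `G`-rigid
extension of `V`. -/
def IsGInjectiveEnvelope (V E : GOperatorSystem G) (κ : V.carrier →ₗ[ℂ] E.carrier) : Prop :=
  IsGEmbedding V E κ ∧ IsGInjective E ∧ IsGEssential V E κ ∧ IsGRigid V E κ

/-- A unital C*-algebra `B` with an action of `G` by *-automorphisms, as a `G`-operator system. -/
def ofCStarAlgebra {B : Type u} [CStarAlgebra B] (α : G →* (B ≃⋆ₐ[ℂ] B)) : GOperatorSystem G where
  Alg := B
  carrier := ⊤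
  one_mem := Submodule.mem_top
  star_mem := fun _ _ => Submodule.mem_top
  ρ :=
    { toFun := fun g =>
        { toFun := fun v => ⟨α g v, Submodule.mem_top⟩
          map_add' := fun v w => Subtype.ext (map_add (α g) (v : B) w)
          map_smul' := fun c v => Subtype.ext (map_smul (α g) c (v : B)) }
      map_one' := by
        ext v
        simp
      map_mul' := fun g h => by
        ext v
        simp }
  ρ_ucp := fun g => by
    refine ⟨Subtype.ext (map_one (α g)), ?_⟩
    rintro n M ⟨N, hN⟩
    refine ⟨N.map (α g), ?_⟩
    ext i j
    have h := congrArg (α g) (congrFun (congrFun hN i) j)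
    refine h.trans ?_
    change α g (∑ k, star (N k i) * N k j) = ∑ k, star (α g (N k i)) * α g (N k j)
    rw [map_sum]
    refine Finset.sum_congr rfl fun k _ => ?_
    exact (map_mul (α g) (star (N k i) : B) (N k j)).trans
      (congrArg (· * α g (N k j)) (map_star (α g) (N k i)))

end GOperatorSystem

/-! ### The `G`-action on `C(X)` -/

/-- The action of `G` on `C(X)` induced by a `G`-space `X`: `(g • f)(x) = f (g⁻¹ • x)`. -/
def translationAction (G : Type u) [Group G] (X : Type u) [TopologicalSpace X]
    [MulAction G X] [ContinuousConstSMul G X] : G →* (C(X, ℂ) ≃⋆ₐ[ℂ] C(X, ℂ)) where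
  toFun g :=
    { toFun := fun f => f.comp ⟨fun x => g⁻¹ • x, continuous_const_smul g⁻¹⟩
      invFun := fun f => f.comp ⟨fun x => g • x, continuous_const_smul g⟩
      left_inv := fun f => by ext x; simp
      right_inv := fun f => by ext x; simp
      map_mul' := fun _ _ => rfl
      map_add' := fun _ _ => rfl
      map_star' := fun _ => rfl
      map_smul' := fun _ _ => rfl }
  map_one' := by
    ext f x
    simp
  map_mul' g h := by
    ext f x
    simp [mul_smul]

/-- `C(X)` as a `G`-operator system. -/
def continuousFunctions (G : Type u) [Group G] (X : Type u) [TopologicalSpace X]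
    [CompactSpace X] [MulAction G X] [ContinuousConstSMul G X] : GOperatorSystem G :=
  GOperatorSystem.ofCStarAlgebra (translationAction G X)

/-! ### The semigroup `βG` -/

section StoneCech

variable {G : Type u} [Group G]

attribute [local instance] Ultrafilter.semigroup

/-- `L` is a left ideal of `βG`, the space of ultrafilters on `G` with the product for which
`u ↦ u * v` is the continuous extension of `g ↦ g • v`. -/
def IsLeftIdeal (L : Set (Ultrafilter G)) : Prop :=
  L.Nonempty ∧ ∀ u : Ultrafilter G, ∀ v ∈ L, u * v ∈ L

/-- Minimal left ideals of `βG`. -/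
def IsMinimalLeftIdeal (L : Set (Ultrafilter G)) : Prop :=
  Minimal IsLeftIdeal L

/-- Left multiplication by a group element is continuous on `βG`. -/
theorem continuous_pure_mul (g : G) :
    Continuous fun v : Ultrafilter G => (pure g : Ultrafilter G) * v :=
  ultrafilterBasis_is_basis.continuous_iff.2 <| Set.forall_mem_range.mpr fun s =>
    ultrafilter_isOpen_basic {m : G | g * m ∈ s}

/-- The action of `g : G` on a left ideal `L` of `βG`, by left multiplication with the principal
ultrafilter of `g`. -/
def leftIdealTranslation {L : Set (Ultrafilter G)} (hL : IsLeftIdeal L) (g : G) : C(L, L) where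
  toFun v := ⟨(pure g : Ultrafilter G) * (v : Ultrafilter G), hL.2 _ _ v.2⟩
  continuous_toFun := ((continuous_pure_mul g).comp continuous_subtype_val).subtype_mk _

end StoneCech

end

noncomputable section

/-! Everything takes place inside `ℓ^∞(G)`. A state `s` of a `G`-operator system `W` has a Poisson
map `w ↦ (g ↦ s (g⁻¹ w))` into `ℓ^∞(G)`, and an equivariant map into `ℓ^∞(G)` is the Poisson map of
its composite with evaluation at `1`. As states extend, `ℓ^∞(G)` is `G`-injective. If `X` is
minimal, the Poisson map of a point evaluation embeds `C(X)`, because a function that is nonnegative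
on a dense orbit is nonnegative.

Existence follows Hamana. Among the equivariant unital positive maps of `ℓ^∞(G)` that fix the image
of `C(X)`, choose `φ` with `f ↦ ‖φ f‖` minimal. Cesàro means show that `φ` is idempotent
(`idempotent`), and minimality makes its range rigid (`eq_of_absorb`). The range is a retract of
`ℓ^∞(G)`, hence `G`-injective, and injectivity with rigidity gives essentiality. The Choi–Effros
product `a * b = φ (a b)` turns it into a commutative C*-algebra `B`. Envelopes are unique, so every
envelope is isomorphic to `B`.

For the map into `C(L)`, take any character of `B`. Its Poisson map restricts on `C(X)` to the
Poisson map of a character of `C(X)`, that is, of a point evaluation, which is an embedding. By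
essentiality the Poisson map on `B` is injective as well: the `G`-orbit of every character separates
`B`. Extending one orbit map to `βG`, restricting it to `L` and dualizing gives an equivariant
*-homomorphism `B → C(L)`. It is injective because its image in the spectrum contains a full
`G`-orbit. -/

/-- Positive elements of a C*-algebra, in the form used for the matrix orders. -/
def IsPos {A : Type*} [CStarAlgebra A] (a : A) : Prop := ∃ b : A, a = star b * b

/-! ### Positive elements of C*-algebras and positive matrices over commutative ones. -/

namespace IsPos

section Basic

variable {A B : Type*} [CStarAlgebra A] [CStarAlgebra B]

theorem iff_nonneg [PartialOrder A] [StarOrderedRing A] {a : A} : IsPos a ↔ 0 ≤ a :=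
  CStarAlgebra.nonneg_iff_eq_star_mul_self.symm

theorem star_mul_self (a : A) : IsPos (star a * a) := ⟨a, rfl⟩

theorem zero : IsPos (0 : A) := ⟨0, by simp⟩

theorem one : IsPos (1 : A) := ⟨1, by simp⟩

theorem isSelfAdjoint {a : A} (h : IsPos a) : IsSelfAdjoint a := by
  obtain ⟨b, rfl⟩ := h
  exact .star_mul_self b

theorem add {a b : A} (ha : IsPos a) (hb : IsPos b) : IsPos (a + b) := by
  let _ := CStarAlgebra.spectralOrder A
  have := CStarAlgebra.spectralOrderedRing A
  rw [iff_nonneg] at *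
  exact add_nonneg ha hb

theorem sum {ι : Type*} (s : Finset ι) {f : ι → A} (h : ∀ i ∈ s, IsPos (f i)) :
    IsPos (∑ i ∈ s, f i) :=
  Finset.sum_induction f IsPos (fun _ _ => add) zero h

theorem smul {a : A} (ha : IsPos a) {r : ℝ} (hr : 0 ≤ r) : IsPos ((r : ℂ) • a) := by
  obtain ⟨b, rfl⟩ := ha
  refine ⟨((√r : ℝ) : ℂ) • b, ?_⟩
  rw [star_smul, smul_mul_smul_comm]
  congr 1
  rw [Complex.star_def, Complex.conj_ofReal, ← Complex.ofReal_mul, Real.mul_self_sqrt hr]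

theorem eq_zero {a : A} (ha : IsPos a) (hb : IsPos (-a)) : a = 0 := by
  let _ := CStarAlgebra.spectralOrder A
  have := CStarAlgebra.spectralOrderedRing A
  rw [iff_nonneg] at *
  exact le_antisymm (neg_nonneg.1 hb) ha

theorem norm_smul_one_sub {a : A} (ha : IsSelfAdjoint a) {r : ℝ} (hr : ‖a‖ ≤ r) :
    IsPos ((r : ℂ) • (1 : A) - a) := by
  let _ := CStarAlgebra.spectralOrder A
  have := CStarAlgebra.spectralOrderedRing A
  rw [iff_nonneg, sub_nonneg]
  have h := ha.le_algebraMap_norm_self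
  rw [Algebra.algebraMap_eq_smul_one] at h
  refine h.trans ?_
  have h2 : IsPos (((r - ‖a‖ : ℝ) : ℂ) • (1 : A)) := one.smul (sub_nonneg.2 hr)
  rw [iff_nonneg, Complex.ofReal_sub, sub_smul, sub_nonneg] at h2
  simpa using h2

theorem norm_smul_one_add {a : A} (ha : IsSelfAdjoint a) {r : ℝ} (hr : ‖a‖ ≤ r) :
    IsPos ((r : ℂ) • (1 : A) + a) := by
  simpa using norm_smul_one_sub ha.neg (r := r) (by simpa using hr)

/-- Positivity of a self-adjoint element can be read off from the norm and the unit. -/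
theorem of_norm_sub_le {a : A} (ha : IsSelfAdjoint a) {r : ℝ}
    (h : ‖(r : ℂ) • (1 : A) - a‖ ≤ r) : IsPos a := by
  have hs : IsSelfAdjoint ((r : ℂ) • (1 : A) - a) := by
    refine IsSelfAdjoint.sub (IsSelfAdjoint.smul ?_ (.one A)) ha
    exact Complex.conj_ofReal r
  simpa using norm_smul_one_sub hs h

/-- From `0 ≤ r - a ≤ r`. With `of_norm_sub_le` this describes positivity by norm, unit and
involution alone; these are what the range of a projection shares with `ℓ^∞(G)`, its product being
different. -/
theorem norm_sub_le {a : A} (ha : IsPos a) {r : ℝ} (hr : ‖a‖ ≤ r) :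
    ‖(r : ℂ) • (1 : A) - a‖ ≤ r := by
  let _ := CStarAlgebra.spectralOrder A
  have := CStarAlgebra.spectralOrderedRing A
  have h0 := norm_smul_one_sub ha.isSelfAdjoint hr
  have hr0 : 0 ≤ r := (norm_nonneg a).trans hr
  rw [CStarAlgebra.norm_le_iff_le_algebraMap _ hr0 (iff_nonneg.1 h0),
    Algebra.algebraMap_eq_smul_one, ← Complex.coe_smul r (1 : A)]
  exact sub_le_self _ (iff_nonneg.1 ha)

theorem norm_le_norm {a b : A} (ha : IsPos a) (hab : IsPos (b - a)) : ‖a‖ ≤ ‖b‖ := by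
  let _ := CStarAlgebra.spectralOrder A
  have := CStarAlgebra.spectralOrderedRing A
  rw [iff_nonneg] at *
  exact CStarAlgebra.norm_le_norm_of_nonneg_of_le ha (sub_nonneg.1 hab)

theorem map {F : Type*} [FunLike F A B] [AlgHomClass F ℂ A B] [StarHomClass F A B] (f : F)
    {a : A} (ha : IsPos a) : IsPos (f a) := by
  obtain ⟨b, rfl⟩ := ha
  exact ⟨f b, by rw [map_mul, map_star]⟩

theorem of_spectrum {a : A} (ha : IsSelfAdjoint a) (h : ∀ r ∈ spectrum ℝ a, 0 ≤ r) :
    IsPos a := by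
  let _ := CStarAlgebra.spectralOrder A
  have := CStarAlgebra.spectralOrderedRing A
  rw [iff_nonneg]
  exact (StarOrderedRing.nonneg_iff_spectrum_nonneg (R := ℝ) a ha).2 h

theorem complex_iff {z : ℂ} : IsPos z ↔ 0 ≤ z.re ∧ z.im = 0 := by
  constructor
  · rintro ⟨b, rfl⟩
    simp only [Complex.star_def, ← Complex.normSq_eq_conj_mul_self]
    exact ⟨Complex.normSq_nonneg b, by simp⟩
  · rintro ⟨h, h'⟩
    have := (one (A := ℂ)).smul h
    rwa [smul_eq_mul, mul_one, show ((z.re : ℝ) : ℂ) = z from Complex.ext rfl h'.symm] at this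

end Basic

section Matrix

variable {A : Type*} [CStarAlgebra A] {n : ℕ}

/-- A positive matrix has positive compressions by scalar vectors. -/
theorem compression {M : Matrix (Fin n) (Fin n) A}
    (hM : ∃ N : CStarMatrix (Fin n) (Fin n) A, CStarMatrix.ofMatrix M = star N * N)
    (c : Fin n → ℂ) : IsPos (∑ i, ∑ j, (star (c i) * c j) • M i j) := by
  obtain ⟨N, hN⟩ := hM
  have h (i j : Fin n) : M i j = ∑ k, star (N k i) * N k j := congrFun (congrFun hN i) j
  have : ∑ i, ∑ j, (star (c i) * c j) • M i j =
      ∑ k, star (∑ j, c j • N k j) * ∑ j, c j • N k j := by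
    simp only [h, Finset.smul_sum, star_sum, Finset.sum_mul, Finset.mul_sum, star_smul,
      smul_mul_smul_comm]
    rw [Finset.sum_congr rfl fun i _ => Finset.sum_comm, Finset.sum_comm,
      Finset.sum_congr rfl fun k _ => Finset.sum_comm]
  rw [this]
  exact sum _ fun k _ => star_mul_self _

end Matrix

section Comm

variable {A : Type*} [CommCStarAlgebra A] {n : ℕ}

open scoped ComplexOrder MatrixOrder in
theorem _root_.Matrix.posSemidef_of_compression {H : Matrix (Fin n) (Fin n) ℂ}
    (h : ∀ c : Fin n → ℂ, IsPos (∑ i, ∑ j, (star (c i) * c j) • H i j)) : H.PosSemidef := by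
  rw [← Matrix.isPositive_toEuclideanLin_iff, LinearMap.isPositive_iff_complex]
  intro x
  have h1 := complex_iff.1 (h x)
  have : inner ℂ (Matrix.toEuclideanLin H x) x = star (∑ i, ∑ j, (star (x i) * x j) • H i j) := by
    simp only [Matrix.toLpLin_apply, PiLp.inner_apply, Matrix.mulVec, dotProduct, star_sum,
      RCLike.inner_apply, map_sum, Finset.mul_sum, smul_eq_mul]
    refine Finset.sum_congr rfl fun i _ => Finset.sum_congr rfl fun j _ => ?_
    simp
    ring
  have h3 : star (∑ i, ∑ j, (star (x i) * x j) • H i j) = ∑ i, ∑ j, (star (x i) * x j) • H i j :=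
    Complex.conj_eq_iff_im.2 h1.2
  rw [this, h3]
  exact ⟨Complex.ext rfl h1.2.symm, h1.1⟩

open scoped ComplexOrder MatrixOrder in
/-- In a commutative C*-algebra, a matrix all whose scalar compressions are positive is
positive. -/
theorem matrix_of_compression {M : Matrix (Fin n) (Fin n) A}
    (h : ∀ c : Fin n → ℂ, IsPos (∑ i, ∑ j, (star (c i) * c j) • M i j)) :
    ∃ N : CStarMatrix (Fin n) (Fin n) A, CStarMatrix.ofMatrix M = star N * N := by
  let _ := CStarAlgebra.spectralOrder A
  have := CStarAlgebra.spectralOrderedRing A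
  rcases subsingleton_or_nontrivial A with hA | hA
  · exact ⟨0, by ext i j; exact Subsingleton.elim _ _⟩
  -- Characters preserve the compressions, so the problem is reduced to scalar matrices.
  have hpsd (χ : WeakDual.characterSpace ℂ A) : (M.map χ).PosSemidef := by
    refine Matrix.posSemidef_of_compression fun c => ?_
    simpa using (h c).map χ
  have hsa : IsSelfAdjoint (CStarMatrix.ofMatrix M) := by
    ext i j
    change star (M j i) = M i j
    refine (gelfandTransform_bijective A).injective ?_
    ext χ
    have := congrFun (congrFun (hpsd χ).isHermitian i) j
    simpa [map_star] using this
  change IsPos (CStarMatrix.ofMatrix M)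
  refine of_spectrum hsa fun r hr => ?_
  -- A spectral value `r` makes `det (r - M)` a non-unit of the commutative algebra `A`. Some
  -- character `χ` kills it, so `r` is an eigenvalue of the positive semidefinite matrix `χ(M)`.
  have hu : ¬ IsUnit (algebraMap ℝ (Matrix (Fin n) (Fin n) A) r - M) := by
    intro H
    have hr' : ¬ IsUnit (algebraMap ℝ (CStarMatrix (Fin n) (Fin n) A) r - CStarMatrix.ofMatrix M) :=
      hr
    refine hr' ?_
    have h1 := H.map (CStarMatrix.ofMatrixRingEquiv (n := Fin n) (A := A))
    rw [map_sub] at h1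
    convert h1 using 1
    refine congrArg (· - CStarMatrix.ofMatrix M) ?_
    ext i j
    simp only [Algebra.algebraMap_eq_smul_one]
    change r • (1 : Matrix (Fin n) (Fin n) A) i j = (r • (1 : Matrix (Fin n) (Fin n) A)) i j
    simp
  rw [Matrix.isUnit_iff_isUnit_det] at hu
  obtain ⟨χ, hχ⟩ := WeakDual.CharacterSpace.exists_apply_eq_zero hu
  have hspec : (r : ℂ) ∈ spectrum ℂ (M.map χ) := by
    rw [spectrum.mem_iff, Matrix.isUnit_iff_isUnit_det, isUnit_iff_ne_zero, not_not, ← hχ]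
    have := RingHom.map_det (χ : A →+* ℂ) (algebraMap ℝ (Matrix (Fin n) (Fin n) A) r - M)
    refine Eq.trans ?_ this.symm
    congr 1
    ext i j
    have hr : χ (algebraMap ℝ A r) = (r : ℂ) := by
      rw [IsScalarTower.algebraMap_apply ℝ ℂ A, AlgHomClass.commutes]
      rfl
    by_cases hij : i = j
    · subst hij
      simp [Matrix.algebraMap_matrix_apply, hr]
    · simp [Matrix.algebraMap_matrix_apply, hij]
  simpa using (Matrix.posSemidef_iff_isHermitian_and_spectrum_nonneg.1 (hpsd χ)).2 hspec

end Comm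

end IsPos

/-! ### Unital positive maps and extension of states. -/

namespace OperatorSystem

variable {S T W : OperatorSystem.{u}}

@[simp] theorem coe_unit : (S.unit : S.Alg) = 1 := rfl

/-- The involution of an operator system. -/
def adj (v : S.carrier) : S.carrier := ⟨star (v : S.Alg), S.star_mem _ v.2⟩

@[simp] theorem coe_adj (v : S.carrier) : (adj v : S.Alg) = star (v : S.Alg) := rfl

theorem MatrixPos.compression {n : ℕ} {M : Matrix (Fin n) (Fin n) S.carrier} (hM : S.MatrixPos M)
    (c : Fin n → ℂ) : IsPos ((∑ i, ∑ j, (star (c i) * c j) • M i j : S.carrier) : S.Alg) := by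
  simpa using IsPos.compression hM c

theorem matrixPos_of_compression (hS : ∀ a b : S.Alg, a * b = b * a) {n : ℕ}
    {M : Matrix (Fin n) (Fin n) S.carrier}
    (hM : ∀ c : Fin n → ℂ,
      IsPos ((∑ i, ∑ j, (star (c i) * c j) • M i j : S.carrier) : S.Alg)) : S.MatrixPos M := by
  let _ : CommCStarAlgebra S.Alg := { S.cstar with mul_comm := hS }
  exact IsPos.matrix_of_compression (A := S.Alg) (M := M.map fun v => (v : S.Alg)) fun c => by
    simpa using hM c

theorem matrixPos_const {v : S.carrier} :
    S.MatrixPos (Matrix.of fun _ _ : Fin 1 => v) ↔ IsPos (v : S.Alg) := by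
  constructor
  · intro h
    simpa using h.compression fun _ => 1
  · rintro ⟨b, hb⟩
    refine ⟨CStarMatrix.ofMatrix (Matrix.of fun _ _ => b), ?_⟩
    ext i j
    change (v : S.Alg) = ∑ _k : Fin 1, star b * b
    simpa using hb

theorem IsUCP.isPos {f : S.carrier →ₗ[ℂ] T.carrier} (hf : IsUCP f) {v : S.carrier}
    (hv : IsPos (v : S.Alg)) : IsPos (f v : T.Alg) :=
  matrixPos_const.1 (hf.2 1 _ (matrixPos_const.2 hv))

theorem IsCompleteOrderEmbedding.isUCP {f : S.carrier →ₗ[ℂ] T.carrier}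
    (hf : IsCompleteOrderEmbedding f) : IsUCP f :=
  ⟨hf.1, fun n M hM => (hf.2 n M).1 hM⟩

theorem IsCompleteOrderEmbedding.isPos_iff {f : S.carrier →ₗ[ℂ] T.carrier}
    (hf : IsCompleteOrderEmbedding f) {v : S.carrier} :
    IsPos (f v : T.Alg) ↔ IsPos (v : S.Alg) :=
  ⟨fun h => matrixPos_const.1 ((hf.2 1 _).2 (matrixPos_const.2 h)), hf.isUCP.isPos⟩

theorem IsCompleteOrderEmbedding.injective {f : S.carrier →ₗ[ℂ] T.carrier}
    (hf : IsCompleteOrderEmbedding f) : Function.Injective f := by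
  refine (injective_iff_map_eq_zero f).2 fun v hv => Subtype.ext ?_
  refine IsPos.eq_zero (hf.isPos_iff.1 ?_) ?_
  · rw [hv]; exact IsPos.zero
  · have : IsPos ((-v : S.carrier) : S.Alg) := by
      rw [← hf.isPos_iff, map_neg, hv, neg_zero]
      exact IsPos.zero
    simpa using this

theorem IsUCP.comp {g : T.carrier →ₗ[ℂ] W.carrier} {f : S.carrier →ₗ[ℂ] T.carrier}
    (hg : IsUCP g) (hf : IsUCP f) : IsUCP (g ∘ₗ f) :=
  ⟨by rw [LinearMap.comp_apply, hf.1, hg.1], fun n M hM => hg.2 n _ (hf.2 n M hM)⟩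

/-- A unital completely positive map with a unital completely positive left inverse is a complete
order embedding. -/
theorem IsUCP.isCompleteOrderEmbedding {f : S.carrier →ₗ[ℂ] T.carrier}
    {g : T.carrier →ₗ[ℂ] S.carrier} (hf : IsUCP f) (hg : IsUCP g) (h : g ∘ₗ f = LinearMap.id) :
    IsCompleteOrderEmbedding f := by
  refine ⟨hf.1, fun n M => ⟨hf.2 n M, fun hM => ?_⟩⟩
  have := hg.2 n _ hM
  rwa [Matrix.map_map, ← LinearMap.coe_comp, h, LinearMap.id_coe, Matrix.map_id] at this

section PosUnital

variable {A : Type*} [CStarAlgebra A]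

/-- Unital positive maps from an operator system into a C*-algebra. -/
def IsPosUnital (f : S.carrier →ₗ[ℂ] A) : Prop :=
  f S.unit = 1 ∧ ∀ v : S.carrier, IsPos (v : S.Alg) → IsPos (f v)

theorem IsUCP.isPosUnital {f : S.carrier →ₗ[ℂ] T.carrier} (hf : IsUCP f) :
    IsPosUnital (T.carrier.subtype ∘ₗ f) :=
  ⟨congrArg Subtype.val hf.1, fun _ hv => hf.isPos hv⟩

theorem IsPosUnital.comp_isUCP {f : T.carrier →ₗ[ℂ] A} (hf : IsPosUnital f)
    {g : S.carrier →ₗ[ℂ] T.carrier} (hg : IsUCP g) : IsPosUnital (f ∘ₗ g) :=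
  ⟨by rw [LinearMap.comp_apply, hg.1, hf.1], fun _ hv => hf.2 _ (hg.isPos hv)⟩

/-- Scalar compressions commute with linear maps and detect matrix positivity over a commutative
algebra. Hence only plain positivity has to be checked for maps into commutative targets. -/
theorem IsPosUnital.isUCP (hT : ∀ a b : T.Alg, a * b = b * a) {f : S.carrier →ₗ[ℂ] T.carrier}
    (hf : IsPosUnital (T.carrier.subtype ∘ₗ f)) : IsUCP f := by
  refine ⟨Subtype.ext hf.1, fun n M hM => matrixPos_of_compression hT fun c => ?_⟩
  simpa using hf.2 _ (hM.compression c)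

/-- A unital map between operator systems in commutative C*-algebras is a complete order embedding
as soon as it is an order embedding. -/
theorem isCompleteOrderEmbedding_of_isPos_iff (hS : ∀ a b : S.Alg, a * b = b * a)
    (hT : ∀ a b : T.Alg, a * b = b * a) {f : S.carrier →ₗ[ℂ] T.carrier} (h1 : f S.unit = T.unit)
    (h : ∀ v : S.carrier, IsPos (f v : T.Alg) ↔ IsPos (v : S.Alg)) :
    IsCompleteOrderEmbedding f := by
  refine ⟨h1, fun n M => ⟨fun hM => matrixPos_of_compression hT fun c => ?_,
    fun hM => matrixPos_of_compression hS fun c => ?_⟩⟩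
  · have := (h _).2 (hM.compression c)
    simpa using this
  · rw [← h]
    simpa using hM.compression c

theorem norm_unit_sub_isPos {v : S.carrier} (hv : IsSelfAdjoint (v : S.Alg)) :
    IsPos (((‖v‖ : ℂ) • S.unit - v : S.carrier) : S.Alg) := by
  simpa using IsPos.norm_smul_one_sub hv le_rfl

theorem IsPosUnital.isSelfAdjoint {f : S.carrier →ₗ[ℂ] A} (hf : IsPosUnital f) {v : S.carrier}
    (hv : IsSelfAdjoint (v : S.Alg)) : IsSelfAdjoint (f v) := by
  have h := (hf.2 _ (norm_unit_sub_isPos hv)).isSelfAdjoint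
  rw [map_sub, map_smul, hf.1] at h
  have h2 : IsSelfAdjoint ((‖v‖ : ℂ) • (1 : A)) :=
    IsSelfAdjoint.smul (Complex.conj_ofReal _) (.one A)
  simpa using h2.sub h

theorem IsPosUnital.map_adj {f : S.carrier →ₗ[ℂ] A} (hf : IsPosUnital f) (v : S.carrier) :
    f (adj v) = star (f v) := by
  have h1 := hf.isSelfAdjoint (v := v + adj v) (by simp [IsSelfAdjoint, add_comm])
  have h2 := hf.isSelfAdjoint (v := Complex.I • (v - adj v)) (by simp [IsSelfAdjoint, ← smul_neg])
  rw [map_add, isSelfAdjoint_iff, star_add] at h1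
  rw [map_smul, map_sub, isSelfAdjoint_iff, star_smul, star_sub, Complex.star_def, Complex.conj_I,
    neg_smul, ← smul_neg] at h2
  have h3 := smul_right_injective A Complex.I_ne_zero h2
  have h4 : (2 : ℂ) • f (adj v) = (2 : ℂ) • star (f v) := by
    rw [two_smul, two_smul]
    have h5 : f (adj v) + f (adj v) = f v + f (adj v) - (f v - f (adj v)) := by abel
    rw [h5, ← h1, ← h3]
    abel
  exact smul_right_injective A two_ne_zero h4

/-- A crude norm bound for states. -/
theorem IsPosUnital.norm_le {s : S.carrier →ₗ[ℂ] ℂ} (hs : IsPosUnital s) (v : S.carrier) :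
    ‖s v‖ ≤ 2 * ‖v‖ := by
  -- The factor `2` arises because real and imaginary parts are bounded separately; the bound serves
  -- only to make Poisson maps take bounded values.
  have key (w : S.carrier) (hw : IsSelfAdjoint (w : S.Alg)) : |(s w).re| ≤ ‖w‖ := by
    have h1 := IsPos.complex_iff.1 (hs.2 _ (norm_unit_sub_isPos hw))
    have h2 := IsPos.complex_iff.1 (hs.2 _ (norm_unit_sub_isPos (v := -w) (by simpa using hw.neg)))
    rw [map_sub, map_smul, hs.1] at h1 h2
    simp at h1 h2
    change |(s w).re| ≤ ‖(w : S.Alg)‖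
    rw [abs_le]
    constructor <;> linarith [h1.1, h2.1]
  have hn : ‖adj v‖ = ‖v‖ := norm_star (v : S.Alg)
  have h1 := key (v + adj v) (by simp [IsSelfAdjoint, add_comm])
  have h2 := key (Complex.I • (v - adj v)) (by simp [IsSelfAdjoint, ← smul_neg])
  rw [map_add, hs.map_adj] at h1
  rw [map_smul, map_sub, hs.map_adj, norm_smul, Complex.norm_I, one_mul] at h2
  have h3 := norm_add_le v (adj v)
  have h4 := norm_sub_le v (adj v)
  have h5 := Complex.norm_le_abs_re_add_abs_im (s v)
  have h6 : (s v + star (s v)).re = 2 * (s v).re := by simp [two_mul]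
  have h7 : (Complex.I • (s v - star (s v))).re = -(2 * (s v).im) := by simp [two_mul]
  rw [h6, abs_mul, abs_two] at h1
  rw [h7, abs_neg, abs_mul, abs_two] at h2
  linarith

end PosUnital

open Complex in
/-- States extend along complete order embeddings. -/
theorem exists_state_extension {V W : OperatorSystem.{u}} {j : V.carrier →ₗ[ℂ] W.carrier}
    (hj : IsCompleteOrderEmbedding j) {s : V.carrier →ₗ[ℂ] ℂ} (hs : IsPosUnital s) :
    ∃ t : W.carrier →ₗ[ℂ] ℂ, IsPosUnital t ∧ t ∘ₗ j = s := by
  have hjstar (v : V.carrier) : j (adj v) = adj (j v) :=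
    Subtype.ext (hj.isUCP.isPosUnital.map_adj v)
  -- The M. Riesz extension theorem is applied to the real part of `s`. The cone consists of the
  -- elements with positive real part, so it contains all skew-adjoint elements, and a functional
  -- that is nonnegative on it vanishes on those.
  let C : PointedCone ℝ W.carrier :=
    { carrier := {w | IsPos ((w + adj w : W.carrier) : W.Alg)}
      zero_mem' := by simpa using IsPos.zero
      add_mem' := fun {a b} ha hb => by
        have := IsPos.add ha hb
        simp only [Set.mem_ofPred_eq, Submodule.coe_add, coe_adj, star_add] at this ⊢
        convert this using 1
        abel
      smul_mem' := fun c w hw => by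
        have := IsPos.smul hw c.2
        simp only [Set.mem_ofPred_eq, Submodule.coe_add, coe_adj] at this ⊢
        have hc : ((c • w : W.carrier) : W.Alg) = ((c : ℝ) : ℂ) • (w : W.Alg) := by
          rw [Complex.coe_smul]
          rfl
        rw [hc, star_smul, Complex.star_def, Complex.conj_ofReal, ← smul_add]
        exact this }
  have hjr : Function.Injective (j.restrictScalars ℝ) := hj.injective
  let e := LinearEquiv.ofInjective (j.restrictScalars ℝ) hjr
  let f : W.carrier →ₗ.[ℝ] ℝ :=
    { domain := LinearMap.range (j.restrictScalars ℝ)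
      toFun := reLm ∘ₗ s.restrictScalars ℝ ∘ₗ e.symm.toLinearMap }
  have hf (v : V.carrier) : f (e v) = (s v).re := by
    change (s (e.symm (e v))).re = _
    rw [e.symm_apply_apply]
  obtain ⟨g, hg, hgC⟩ := riesz_extension C f (by
      intro x hx
      obtain ⟨v, rfl⟩ := e.surjective x
      rw [hf]
      have h1 : IsPos ((j v + adj (j v) : W.carrier) : W.Alg) := hx
      rw [← hjstar, ← map_add, hj.isPos_iff] at h1
      have h2 := (IsPos.complex_iff.1 (hs.2 _ h1)).1
      rw [map_add, hs.map_adj] at h2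
      simp at h2
      linarith) (by
      intro y
      -- The unit is an order unit: a large multiple of it moves `y` into the cone.
      refine ⟨e ((‖y + adj y‖ : ℂ) • V.unit), ?_⟩
      have hsa : IsSelfAdjoint ((y + adj y : W.carrier) : W.Alg) := by
        simp [IsSelfAdjoint, add_comm]
      have h1 := (IsPos.one (A := W.Alg)).smul (norm_nonneg (y + adj y))
      have h2 := IsPos.norm_smul_one_add hsa (r := ‖y + adj y‖) le_rfl
      have h3 : ((e ((‖y + adj y‖ : ℂ) • V.unit) : W.carrier) : W.Alg) =
          (‖y + adj y‖ : ℂ) • (1 : W.Alg) := by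
        change ((j ((‖y + adj y‖ : ℂ) • V.unit) : W.carrier) : W.Alg) = _
        rw [map_smul, hj.1]
        rfl
      change IsPos (_ : W.Alg)
      convert h1.add h2 using 1
      simp only [Submodule.coe_add, coe_adj, h3, star_add, star_smul, Complex.star_def,
        Complex.conj_ofReal, star_one]
      abel)
  have hgj (v : V.carrier) : g (j v) = (s v).re := (hg (e v)).trans (hf v)
  let t : W.carrier →ₗ[ℂ] ℂ := Module.Dual.extendRCLike (𝕜 := ℂ) g
  have htre (w : W.carrier) : (t w).re = g w := Module.Dual.re_extendRCLike_apply (𝕜 := ℂ) g w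
  have htim (w : W.carrier) : (t w).im = -g (Complex.I • w) :=
    Module.Dual.im_extendRCLike_apply (𝕜 := ℂ) g w
  have hext : t ∘ₗ j = s := by
    ext v
    apply Complex.ext
    · exact (htre _).trans (hgj v)
    · refine (htim _).trans ?_
      rw [← map_smul, hgj]
      simp
  refine ⟨t, ⟨?_, fun w hw => ?_⟩, hext⟩
  · rw [← hj.1, ← LinearMap.comp_apply, hext, hs.1]
  · have hsa : star (w : W.Alg) = w := hw.isSelfAdjoint
    have h1 : 0 ≤ g w := hgC w (by
      change IsPos ((w : W.Alg) + star (w : W.Alg))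
      rw [hsa]
      exact hw.add hw)
    -- Since `w` is self-adjoint, both `i w` and `-i w` have real part zero and lie in the cone.
    have h2 : g (Complex.I • w) = 0 := by
      refine le_antisymm ?_ (hgC _ ?_)
      · rw [← neg_nonneg, ← map_neg]
        refine hgC _ ?_
        change IsPos (_ : W.Alg)
        simpa [hsa] using IsPos.zero (A := W.Alg)
      · change IsPos (_ : W.Alg)
        simpa [hsa] using IsPos.zero (A := W.Alg)
    refine IsPos.complex_iff.2 ⟨?_, ?_⟩
    · exact h1.trans_eq (htre w).symm
    · rw [htim, h2, neg_zero]

end OperatorSystem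

open scoped BoundedContinuousFunction

/-! ### Formal properties of `G`-injective envelopes. -/

namespace GOperatorSystem

open OperatorSystem

variable {G : Type u} [Group G] {S T W V E F : GOperatorSystem G}

theorem IsGMorphism.comp {g : T.carrier →ₗ[ℂ] W.carrier} {f : S.carrier →ₗ[ℂ] T.carrier}
    (hg : IsGMorphism T W g) (hf : IsGMorphism S T f) : IsGMorphism S W (g ∘ₗ f) :=
  ⟨hg.1.comp hf.1, fun a v => by simp only [LinearMap.comp_apply, hf.2, hg.2]⟩

theorem IsGEmbedding.isGMorphism {f : S.carrier →ₗ[ℂ] T.carrier} (hf : IsGEmbedding S T f) :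
    IsGMorphism S T f :=
  ⟨hf.1.isUCP, hf.2⟩

theorem IsGMorphism.isGEmbedding {f : S.carrier →ₗ[ℂ] T.carrier} {g : T.carrier →ₗ[ℂ] S.carrier}
    (hf : IsGMorphism S T f) (hg : IsGMorphism T S g) (h : g ∘ₗ f = LinearMap.id) :
    IsGEmbedding S T f :=
  ⟨hf.1.isCompleteOrderEmbedding hg.1 h, hf.2⟩

theorem IsGMorphism.isGEmbedding_of_comp {f : S.carrier →ₗ[ℂ] T.carrier}
    {g : T.carrier →ₗ[ℂ] W.carrier} (hf : IsGMorphism S T f) (hg : IsGMorphism T W g)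
    (h : IsGEmbedding S W (g ∘ₗ f)) : IsGEmbedding S T f :=
  ⟨⟨hf.1.1, fun n M => ⟨hf.1.2 n M, fun hM => (h.1.2 n M).2 (hg.1.2 n _ hM)⟩⟩, hf.2⟩

theorem IsGInjective.of_retract (hE : IsGInjective E) {i : F.carrier →ₗ[ℂ] E.carrier}
    {q : E.carrier →ₗ[ℂ] F.carrier} (hi : IsGMorphism F E i) (hq : IsGMorphism E F q)
    (h : q ∘ₗ i = LinearMap.id) : IsGInjective F := by
  intro V W j φ hj hφ
  obtain ⟨ψ, hψ, hψj⟩ := hE V W j (i ∘ₗ φ) hj (hi.comp hφ)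
  refine ⟨q ∘ₗ ψ, hq.comp hψ, ?_⟩
  rw [LinearMap.comp_assoc, hψj, ← LinearMap.comp_assoc, h, LinearMap.id_comp]

/-- Essentiality is automatic: if `φ ∘ κ` is an embedding, injectivity extends `κ` along it to some
`ψ`. Then `ψ ∘ φ` fixes `V`, so it is the identity by rigidity, and `φ` has a left inverse. -/
theorem isGInjectiveEnvelope_of_rigid {κ : V.carrier →ₗ[ℂ] E.carrier} (hκ : IsGEmbedding V E κ)
    (hE : IsGInjective E) (hr : IsGRigid V E κ) : IsGInjectiveEnvelope V E κ := by
  refine ⟨hκ, hE, fun Z φ hφ hφκ => ?_, hr⟩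
  obtain ⟨ψ, hψ, hψφ⟩ := hE V Z (φ ∘ₗ κ) κ hφκ hκ.isGMorphism
  exact hφ.isGEmbedding hψ (hr _ (hψ.comp hφ) hψφ)

/-- Uniqueness of `G`-injective envelopes. -/
theorem IsGInjectiveEnvelope.exists_equiv {κ : V.carrier →ₗ[ℂ] E.carrier}
    {κ' : V.carrier →ₗ[ℂ] F.carrier} (h : IsGInjectiveEnvelope V E κ)
    (h' : IsGInjectiveEnvelope V F κ') :
    ∃ e : E.carrier ≃ₗ[ℂ] F.carrier, IsGEmbedding E F e.toLinearMap ∧ e.toLinearMap ∘ₗ κ = κ' := by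
  obtain ⟨f, hf, hfκ⟩ := h'.2.1 V E κ κ' h.1 h'.1.isGMorphism
  obtain ⟨g, hg, hgκ⟩ := h.2.1 V F κ' κ h'.1 h.1.isGMorphism
  have hgf : g ∘ₗ f = LinearMap.id :=
    h.2.2.2 _ (hg.comp hf) (by rw [LinearMap.comp_assoc, hfκ, hgκ])
  have hfg : f ∘ₗ g = LinearMap.id :=
    h'.2.2.2 _ (hf.comp hg) (by rw [LinearMap.comp_assoc, hgκ, hfκ])
  exact ⟨LinearEquiv.ofLinearMap f g hfg hgf, hf.isGEmbedding hg hgf, hfκ⟩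

section OfCStarAlgebra

variable {B : Type u}

/-- The identification of a C*-algebra with the carrier of its operator system. -/
def toCarrier [CStarAlgebra B] (α : G →* (B ≃⋆ₐ[ℂ] B)) : B ≃ₗ[ℂ] (ofCStarAlgebra α).carrier :=
  Submodule.topEquiv.symm

@[simp] theorem ρ_toCarrier [CStarAlgebra B] (α : G →* (B ≃⋆ₐ[ℂ] B)) (g : G) (b : B) :
    (ofCStarAlgebra α).ρ g (toCarrier α b) = toCarrier α (α g b) := rfl

/-- Equivariant unital positive maps into a commutative C*-algebra are morphisms. -/
theorem isGMorphism_toCarrier [CommCStarAlgebra B] {α : G →* (B ≃⋆ₐ[ℂ] B)}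
    {f : S.carrier →ₗ[ℂ] B} (hf : IsPosUnital (S := S.toOperatorSystem) f)
    (hα : ∀ g v, f (S.ρ g v) = α g (f v)) :
    IsGMorphism S (ofCStarAlgebra α) ((toCarrier α).toLinearMap ∘ₗ f) :=
  ⟨IsPosUnital.isUCP (T := (ofCStarAlgebra α).toOperatorSystem) (fun a b : B => mul_comm a b) hf,
    fun g v => by simp [hα]⟩

end OfCStarAlgebra

end GOperatorSystem

/-! ### The algebra `ℓ^∞(G)`, Poisson maps and `G`-injectivity. -/

namespace BoundedContinuousFunction

theorem isPos_iff {G : Type*} [TopologicalSpace G] [DiscreteTopology G] {f : G →ᵇ ℂ} :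
    IsPos f ↔ ∀ g, IsPos (f g) := by
  refine ⟨fun ⟨b, hb⟩ g => ⟨b g, by rw [hb]; rfl⟩, fun h => ?_⟩
  refine ⟨ofNormedAddCommGroup (fun g => (√(f g).re : ℂ)) continuous_of_discreteTopology (√‖f‖)
    fun g => ?_, ?_⟩
  · rw [Complex.norm_real, Real.norm_of_nonneg (Real.sqrt_nonneg _)]
    exact Real.sqrt_le_sqrt ((Complex.re_le_norm _).trans (f.norm_coe_le_norm g))
  · ext g
    obtain ⟨h1, h2⟩ := IsPos.complex_iff.1 (h g)
    change f g = star ((√(f g).re : ℝ) : ℂ) * ((√(f g).re : ℝ) : ℂ)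
    rw [Complex.star_def, Complex.conj_ofReal, ← Complex.ofReal_mul, Real.mul_self_sqrt h1]
    exact Complex.ext rfl h2

end BoundedContinuousFunction

/-- The action of `G` on `ℓ^∞(G)` by left translation. -/
def leftTranslation (G : Type u) [Group G] [TopologicalSpace G] [DiscreteTopology G] :
    G →* ((G →ᵇ ℂ) ≃⋆ₐ[ℂ] (G →ᵇ ℂ)) where
  toFun g :=
    { toFun := fun f => f.compContinuous ⟨fun h => g⁻¹ * h, continuous_of_discreteTopology⟩
      invFun := fun f => f.compContinuous ⟨fun h => g * h, continuous_of_discreteTopology⟩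
      left_inv := fun f => by ext x; simp
      right_inv := fun f => by ext x; simp
      map_mul' := fun _ _ => rfl
      map_add' := fun _ _ => rfl
      map_star' := fun _ => rfl
      map_smul' := fun _ _ => rfl }
  map_one' := by
    ext f x
    simp
  map_mul' g h := by
    ext f x
    simp [mul_assoc]
    rfl

theorem leftTranslation_apply {G : Type u} [Group G] [TopologicalSpace G] [DiscreteTopology G]
    (g : G) (f : G →ᵇ ℂ) (h : G) : leftTranslation G g f h = f (g⁻¹ * h) := rfl

theorem leftTranslation_inv_apply_self {G : Type u} [Group G] [TopologicalSpace G]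
    [DiscreteTopology G] (g : G) (f : G →ᵇ ℂ) :
    leftTranslation G g⁻¹ (leftTranslation G g f) = f := by
  ext h
  rw [leftTranslation_apply, leftTranslation_apply]
  simp

theorem leftTranslation_apply_inv_self {G : Type u} [Group G] [TopologicalSpace G]
    [DiscreteTopology G] (g : G) (f : G →ᵇ ℂ) :
    leftTranslation G g (leftTranslation G g⁻¹ f) = f := by
  ext h
  rw [leftTranslation_apply, leftTranslation_apply]
  simp

/-- `ℓ^∞(G)` as a `G`-operator system. -/
abbrev boundedFunctions (G : Type u) [Group G] [TopologicalSpace G] [DiscreteTopology G] :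
    GOperatorSystem G :=
  GOperatorSystem.ofCStarAlgebra (leftTranslation G)

namespace GOperatorSystem

open OperatorSystem

variable {G : Type u} [Group G] [TopologicalSpace G] [DiscreteTopology G] {W : GOperatorSystem G}

/-- The Poisson map `w ↦ (g ↦ s (g⁻¹ w))` of a state `s`. -/
def poisson (s : W.carrier →ₗ[ℂ] ℂ) (hs : IsPosUnital (S := W.toOperatorSystem) s) :
    W.carrier →ₗ[ℂ] (G →ᵇ ℂ) where
  toFun w := BoundedContinuousFunction.ofNormedAddCommGroup (fun g => s (W.ρ g⁻¹ w))
    continuous_of_discreteTopology (2 * ‖w‖) fun g => (hs.comp_isUCP (W.ρ_ucp g⁻¹)).norm_le w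
  map_add' v w := by ext g; simp
  map_smul' c w := by ext g; simp

@[simp] theorem poisson_apply (s : W.carrier →ₗ[ℂ] ℂ)
    (hs : IsPosUnital (S := W.toOperatorSystem) s) (w : W.carrier) (g : G) :
    poisson s hs w g = s (W.ρ g⁻¹ w) := rfl

theorem isPosUnital_poisson (s : W.carrier →ₗ[ℂ] ℂ)
    (hs : IsPosUnital (S := W.toOperatorSystem) s) :
    IsPosUnital (S := W.toOperatorSystem) (poisson s hs) := by
  refine ⟨?_, fun w hw => BoundedContinuousFunction.isPos_iff.2 fun g => ?_⟩
  · ext g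
    exact (hs.comp_isUCP (W.ρ_ucp g⁻¹)).1
  · exact (hs.comp_isUCP (W.ρ_ucp g⁻¹)).2 w hw

theorem poisson_ρ (s : W.carrier →ₗ[ℂ] ℂ) (hs : IsPosUnital (S := W.toOperatorSystem) s) (g : G)
    (w : W.carrier) : poisson s hs (W.ρ g w) = leftTranslation G g (poisson s hs w) := by
  ext h
  rw [leftTranslation_apply, poisson_apply, poisson_apply, mul_inv_rev, inv_inv, map_mul]
  rfl

theorem isGMorphism_poisson (s : W.carrier →ₗ[ℂ] ℂ)
    (hs : IsPosUnital (S := W.toOperatorSystem) s) :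
    IsGMorphism W (boundedFunctions G) ((toCarrier _).toLinearMap ∘ₗ poisson s hs) :=
  isGMorphism_toCarrier (isPosUnital_poisson s hs) (poisson_ρ s hs)

variable (G) in
/-- Evaluation at the neutral element, as a functional on `ℓ^∞(G)`. -/
def evalOne : (boundedFunctions G).carrier →ₗ[ℂ] ℂ :=
  (BoundedContinuousFunction.evalCLM ℂ (1 : G)).toLinearMap ∘ₗ (toCarrier _).symm.toLinearMap

theorem isPosUnital_evalOne :
    IsPosUnital (S := (boundedFunctions G).toOperatorSystem) (evalOne G) :=
  ⟨rfl, fun _ hv => BoundedContinuousFunction.isPos_iff.1 hv 1⟩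

/-- `ℓ^∞(G)` is `G`-injective. -/
theorem isGInjective_boundedFunctions : IsGInjective (boundedFunctions G) := by
  intro V W j φ hj hφ
  -- By equivariance `φ` is the Poisson map of this state, so the Poisson map of an extension `t` of
  -- the state extends `φ`.
  have hs : IsPosUnital (S := V.toOperatorSystem) (evalOne G ∘ₗ φ) :=
    isPosUnital_evalOne.comp_isUCP hφ.1
  obtain ⟨t, ht, htj⟩ := exists_state_extension hj.1 hs
  refine ⟨_, isGMorphism_poisson t ht, ?_⟩
  refine LinearMap.ext fun v => (toCarrier _).symm.injective ?_
  ext g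
  change t (W.ρ g⁻¹ (j v)) = ((toCarrier _).symm (φ v) : G →ᵇ ℂ) g
  rw [← hj.2, ← LinearMap.comp_apply, htj]
  change ((toCarrier _).symm (φ (V.ρ g⁻¹ v)) : G →ᵇ ℂ) 1 = _
  rw [hφ.2]
  change ((toCarrier _).symm (φ v) : G →ᵇ ℂ) (g⁻¹⁻¹ * 1) = _
  rw [inv_inv, mul_one]

end GOperatorSystem

/-! ### Minimal seminorms on `ℓ^∞(G)`. -/

open Filter Topology OperatorSystem GOperatorSystem

variable {G : Type u} [Group G] [TopologicalSpace G] [DiscreteTopology G]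

/-- Equivariant unital positive maps of `ℓ^∞(G)` into itself. -/
structure IsEquivariantPositive (φ : (G →ᵇ ℂ) →ₗ[ℂ] (G →ᵇ ℂ)) : Prop where
  map_one : φ 1 = 1
  map_pos : ∀ f, IsPos f → IsPos (φ f)
  map_translation : ∀ g f, φ (leftTranslation G g f) = leftTranslation G g (φ f)

namespace IsEquivariantPositive

variable {φ ψ : (G →ᵇ ℂ) →ₗ[ℂ] (G →ᵇ ℂ)}

theorem isPosUnital (hφ : IsEquivariantPositive φ) :
    IsPosUnital (S := (boundedFunctions G).toOperatorSystem)
      (φ ∘ₗ (toCarrier (leftTranslation G)).symm.toLinearMap) :=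
  ⟨hφ.map_one, fun _ hv => hφ.map_pos _ hv⟩

theorem map_star (hφ : IsEquivariantPositive φ) (f : G →ᵇ ℂ) : φ (star f) = star (φ f) :=
  hφ.isPosUnital.map_adj (toCarrier _ f)

theorem id : IsEquivariantPositive (LinearMap.id : (G →ᵇ ℂ) →ₗ[ℂ] (G →ᵇ ℂ)) :=
  ⟨rfl, fun _ h => h, fun _ _ => rfl⟩

theorem comp (hφ : IsEquivariantPositive φ) (hψ : IsEquivariantPositive ψ) :
    IsEquivariantPositive (φ ∘ₗ ψ) :=
  ⟨by simp [hψ.map_one, hφ.map_one], fun f hf => hφ.map_pos _ (hψ.map_pos f hf),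
    fun g f => by simp [hψ.map_translation, hφ.map_translation]⟩

/-- The Kadison–Schwarz inequality. -/
theorem schwarz (hφ : IsEquivariantPositive φ) (f : G →ᵇ ℂ) :
    IsPos (φ (star f * f) - star (φ f) * φ f) := by
  refine BoundedContinuousFunction.isPos_iff.2 fun g => ?_
  -- At a fixed point `g`, positivity of `φ (|f - c|²)` with `c` the value of `φ f` there is exactly
  -- the inequality at `g`.
  set c := φ f g with hc
  have h := BoundedContinuousFunction.isPos_iff.1
    (hφ.map_pos _ (IsPos.star_mul_self (f - c • 1))) g
  have h2 : star (f - c • (1 : G →ᵇ ℂ)) * (f - c • 1) =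
      star f * f - c • star f - star c • f + (star c * c) • 1 := by
    ext x
    simp
    ring
  rw [h2, map_add, map_sub, map_sub, map_smul, map_smul, map_smul, hφ.map_one, hφ.map_star] at h
  convert h using 1
  simp [← hc]
  ring

/-- Kadison–Schwarz gives `|φ f|² ≤ φ (|f|²) ≤ ‖f‖²`, with the sharp constant `1` that the seminorm
comparisons need. -/
theorem norm_apply_le (hφ : IsEquivariantPositive φ) (f : G →ᵇ ℂ) : ‖φ f‖ ≤ ‖f‖ := by
  refine (BoundedContinuousFunction.norm_le (norm_nonneg f)).2 fun g => ?_
  have h1 := (IsPos.complex_iff.1 (BoundedContinuousFunction.isPos_iff.1 (hφ.schwarz f) g)).1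
  have h2 : IsPos (((‖f‖ ^ 2 : ℝ) : ℂ) • (1 : G →ᵇ ℂ) - star f * f) :=
    IsPos.norm_smul_one_sub (.star_mul_self f) (by rw [CStarRing.norm_star_mul_self, sq])
  have h3 := (IsPos.complex_iff.1 (BoundedContinuousFunction.isPos_iff.1 (hφ.map_pos _ h2) g)).1
  rw [map_sub, map_smul, hφ.map_one] at h3
  have h4 : (star (φ f g) * φ f g).re = ‖φ f g‖ ^ 2 := by
    rw [Complex.star_def, ← Complex.normSq_eq_conj_mul_self, Complex.ofReal_re,
      Complex.normSq_eq_norm_sq]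
  have h5 : (φ (star f * f) g).re - (star (φ f g) * φ f g).re ≥ 0 := h1
  have h6 : 0 ≤ ‖f‖ ^ 2 - (φ (star f * f) g).re := by
    convert h3 using 1
    simp only [BoundedContinuousFunction.sub_apply, BoundedContinuousFunction.smul_apply,
      BoundedContinuousFunction.coe_one, Pi.one_apply, smul_eq_mul, mul_one, Complex.sub_re,
      Complex.ofReal_re]
  refine le_of_sq_le_sq ?_ (norm_nonneg _)
  linarith

end IsEquivariantPositive

/-- The equivariant unital positive maps of `ℓ^∞(G)` that fix all elements of `D`. -/
def fixingMaps (D : Set (G →ᵇ ℂ)) : Set ((G →ᵇ ℂ) →ₗ[ℂ] (G →ᵇ ℂ)) :=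
  {φ | IsEquivariantPositive φ ∧ ∀ f ∈ D, φ f = f}

namespace fixingMaps

variable {D : Set (G →ᵇ ℂ)} {φ ψ : (G →ᵇ ℂ) →ₗ[ℂ] (G →ᵇ ℂ)}

theorem comp (hφ : φ ∈ fixingMaps D) (hψ : ψ ∈ fixingMaps D) : φ ∘ₗ ψ ∈ fixingMaps D :=
  ⟨hφ.1.comp hψ.1, fun f hf => by simp [hψ.2 f hf, hφ.2 f hf]⟩

/-- Pointwise limits along an ultrafilter. -/
theorem exists_limit {ι : Type*} (U : Ultrafilter ι) (F : ι → fixingMaps D) :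
    ∃ Φ ∈ fixingMaps D, ∀ f g, Tendsto (fun i => (F i).1 f g) U (𝓝 (Φ f g)) := by
  -- Limits are needed only at the point `1`: they form a state, and its Poisson map is the limit at
  -- every other point by equivariance.
  have hex (f : G →ᵇ ℂ) : ∃ z : ℂ, Tendsto (fun i => (F i).1 f 1) U (𝓝 z) := by
    obtain ⟨z, -, hz⟩ := (isCompact_closedBall (0 : ℂ) ‖f‖).ultrafilter_le_nhds
      (U.map fun i => (F i).1 f 1) (by
        refine Filter.le_principal_iff.2 (Filter.mem_map.2 (Filter.univ_mem' fun i => ?_))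
        exact mem_closedBall_zero_iff.2
          (((F i).1 f).norm_coe_le_norm 1 |>.trans ((F i).2.1.norm_apply_le f)))
    exact ⟨z, hz⟩
  choose s hs using hex
  let t : (boundedFunctions G).carrier →ₗ[ℂ] ℂ :=
    { toFun := fun f => s ((toCarrier _).symm f)
      map_add' := fun a b => tendsto_nhds_unique (hs _) (by
        simpa using (hs ((toCarrier _).symm a)).add (hs ((toCarrier _).symm b)))
      map_smul' := fun c a => tendsto_nhds_unique (hs _) (by
        simpa using (hs ((toCarrier _).symm a)).const_mul c) }
  have ht : IsPosUnital (S := (boundedFunctions G).toOperatorSystem) t := by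
    refine ⟨tendsto_nhds_unique (hs 1) ?_, fun v hv => ?_⟩
    · simp [(F _).2.1.map_one]
    · have h (i) := IsPos.complex_iff.1
        (BoundedContinuousFunction.isPos_iff.1 ((F i).2.1.map_pos _ hv) 1)
      have h1 := hs ((toCarrier _).symm v)
      refine IsPos.complex_iff.2 ⟨?_, ?_⟩
      · exact ge_of_tendsto' ((Complex.continuous_re.tendsto _).comp h1) fun i => (h i).1
      · exact tendsto_nhds_unique ((Complex.continuous_im.tendsto _).comp h1)
          (tendsto_const_nhds.congr fun i => (h i).2.symm)
  have hlim (f : G →ᵇ ℂ) (g : G) :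
      Tendsto (fun i => (F i).1 f g) U (𝓝 (poisson t ht (toCarrier _ f) g)) := by
    refine (hs (leftTranslation G g⁻¹ f)).congr fun i => ?_
    rw [(F i).2.1.map_translation, leftTranslation_apply, inv_inv, mul_one]
  have hP := isPosUnital_poisson t ht
  refine ⟨poisson t ht ∘ₗ (toCarrier _).toLinearMap, ⟨⟨hP.1, fun f hf => hP.2 _ hf,
    fun g f => poisson_ρ t ht g (toCarrier (leftTranslation G) f)⟩, fun f hf => ?_⟩,
    hlim⟩
  ext g
  exact tendsto_nhds_unique (hlim f g) (tendsto_const_nhds.congr fun i => by rw [(F i).2.2 f hf])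

/-- Minimality of the seminorm `f ↦ ‖φ f‖`. -/
def IsMinimalSeminorm (D : Set (G →ᵇ ℂ)) (φ : (G →ᵇ ℂ) →ₗ[ℂ] (G →ᵇ ℂ)) : Prop :=
  φ ∈ fixingMaps D ∧ ∀ ψ ∈ fixingMaps D, (∀ f, ‖ψ f‖ ≤ ‖φ f‖) → ∀ f, ‖φ f‖ ≤ ‖ψ f‖

/-- Hamana's minimal seminorms: there is `φ` for which `f ↦ ‖φ f‖` is minimal. -/
theorem exists_isMinimalSeminorm (D : Set (G →ᵇ ℂ)) : ∃ φ, IsMinimalSeminorm D φ := by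
  let r : fixingMaps D → fixingMaps D → Prop := fun a b => ∀ f, ‖b.1 f‖ ≤ ‖a.1 f‖
  have hrefl (a) : r a a := fun f => le_rfl
  have htrans {a b c} (h : r a b) (h' : r b c) : r a c := fun f => (h' f).trans (h f)
  have : ∃ m, ∀ a, r m a → r a m := by
    refine exists_maximal_of_chains_bounded (fun c hc => ?_) htrans
    rcases c.eq_empty_or_nonempty with rfl | hne
    · exact ⟨⟨LinearMap.id, .id, fun _ _ => rfl⟩, by simp⟩
    have : Nonempty c := hne.to_subtype
    -- The filter of tails of the chain; a limit along a finer ultrafilter is an upper bound, since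
    -- pointwise limits do not increase the sup norm.
    let l : Filter c := ⨅ a : c, 𝓟 {b | r a b}
    have hl : l.NeBot := by
      refine Filter.iInf_neBot_of_directed' (fun a b => ?_) fun a =>
        Filter.principal_neBot_iff.2 ⟨a, hrefl _⟩
      have hab : r a b ∨ r b a := by
        by_cases h : a = b
        · exact .inl (h ▸ hrefl _)
        · exact hc a.2 b.2 fun h' => h (Subtype.ext h')
      rcases hab with h | h
      · exact ⟨b, Filter.principal_mono.2 fun x hx => htrans h hx,
          Filter.principal_mono.2 fun x hx => hx⟩
      · exact ⟨a, Filter.principal_mono.2 fun x hx => hx,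
          Filter.principal_mono.2 fun x hx => htrans h hx⟩
    obtain ⟨Φ, hΦ, hlim⟩ := exists_limit (Ultrafilter.of l) (fun b : c => b.1)
    refine ⟨⟨Φ, hΦ⟩, fun a ha f => ?_⟩
    have hev : ∀ᶠ b : c in (Ultrafilter.of l : Filter c), r a b :=
      Ultrafilter.of_le l (Filter.mem_iInf_of_mem (⟨a, ha⟩ : c) (Filter.mem_principal_self _))
    refine (BoundedContinuousFunction.norm_le (norm_nonneg _)).2 fun g => ?_
    refine le_of_tendsto (hlim f g).norm ?_
    filter_upwards [hev] with b hb
    exact ((b.1.1 f).norm_coe_le_norm g).trans (hb f)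
  obtain ⟨m, hm⟩ := this
  exact ⟨m.1, m.2, fun ψ hψ h => hm ⟨ψ, hψ⟩ h⟩

/-- The exponents start at `1`, so that the mean factors through `φ` and its seminorm is at most
that of `φ`. -/
theorem cesaro (hφ : φ ∈ fixingMaps D) (n : ℕ) :
    ((n + 1 : ℝ) : ℂ)⁻¹ • ∑ k ∈ Finset.range (n + 1), φ ^ (k + 1) ∈ fixingMaps D := by
  have hpow (k : ℕ) : φ ^ k ∈ fixingMaps D := by
    induction k with
    | zero => exact ⟨.id, fun _ _ => rfl⟩
    | succ k ih => rw [pow_succ]; exact comp ih hφ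
  have hn : ((n + 1 : ℝ) : ℂ)⁻¹ * (n + 1 : ℂ) = 1 := by
    push_cast
    exact inv_mul_cancel₀ (Nat.cast_add_one_ne_zero n)
  have hmean (f : G →ᵇ ℂ) : ((n + 1 : ℝ) : ℂ)⁻¹ • ∑ _k ∈ Finset.range (n + 1), f = f := by
    rw [Finset.sum_const, Finset.card_range, ← Nat.cast_smul_eq_nsmul ℂ, smul_smul,
      Nat.cast_succ, hn, one_smul]
  refine ⟨⟨?_, fun f hf => ?_, fun g f => ?_⟩, fun f hf => ?_⟩
  · simp only [LinearMap.smul_apply, LinearMap.sum_apply, (hpow _).1.map_one, hmean]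
  · rw [LinearMap.smul_apply, LinearMap.sum_apply, ← Complex.ofReal_inv]
    exact (IsPos.sum _ fun k _ => (hpow _).1.map_pos f hf).smul (by positivity)
  · simp only [LinearMap.smul_apply, LinearMap.sum_apply, (hpow _).1.map_translation, map_smul,
      map_sum]
  · simp only [LinearMap.smul_apply, LinearMap.sum_apply, (hpow _).2 f hf, hmean]

namespace IsMinimalSeminorm

/-- By minimality `‖φ x‖` is at most the norm of every Cesàro mean at `x`. For `x = f - φ f` the
sums telescope and stay bounded, so the means tend to zero and `φ (f - φ f) = 0`. -/
theorem idempotent (hφ : IsMinimalSeminorm D φ) (f : G →ᵇ ℂ) : φ (φ f) = φ f := by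
  have hpow (k : ℕ) (x : G →ᵇ ℂ) : ‖(φ ^ k) x‖ ≤ ‖x‖ := by
    induction k with
    | zero => simp
    | succ k ih => rw [pow_succ']; exact (hφ.1.1.norm_apply_le _).trans ih
  have hle (n : ℕ) (x : G →ᵇ ℂ) :
      ‖φ x‖ ≤ (n + 1 : ℝ)⁻¹ * ‖∑ k ∈ Finset.range (n + 1), (φ ^ (k + 1)) x‖ := by
    have hval (x : G →ᵇ ℂ) :
        ‖(((n + 1 : ℝ) : ℂ)⁻¹ • ∑ k ∈ Finset.range (n + 1), φ ^ (k + 1)) x‖ =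
          (n + 1 : ℝ)⁻¹ * ‖∑ k ∈ Finset.range (n + 1), (φ ^ (k + 1)) x‖ := by
      rw [LinearMap.smul_apply, LinearMap.sum_apply, norm_smul, norm_inv, Complex.norm_real,
        Real.norm_of_nonneg (by positivity)]
    rw [← hval]
    refine hφ.2 _ (cesaro hφ.1 n) (fun y => ?_) x
    rw [hval, inv_mul_le_iff₀ (by positivity)]
    refine (norm_sum_le _ _).trans ((Finset.sum_le_card_nsmul _ _ ‖φ y‖ fun k _ => ?_).trans ?_)
    · rw [pow_succ]
      exact hpow k (φ y)
    · simp
  have htel (n : ℕ) : ∑ k ∈ Finset.range (n + 1), (φ ^ (k + 1)) (f - φ f) =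
      φ f - (φ ^ (n + 2)) f := by
    induction n with
    | zero => simp [pow_succ]
    | succ n ih =>
      rw [Finset.sum_range_succ, ih, map_sub, show φ ^ (n + 1 + 2) = φ ^ (n + 1 + 1) * φ from
        pow_succ _ _]
      simp
  have hbound (n : ℕ) : ‖φ (f - φ f)‖ ≤ (n + 1 : ℝ)⁻¹ * (‖f‖ + ‖f‖) := by
    refine (hle n _).trans ?_
    rw [htel]
    gcongr
    exact (norm_sub_le _ _).trans (add_le_add (hφ.1.1.norm_apply_le f) (hpow _ f))
  have hlim : Tendsto (fun n : ℕ => (n + 1 : ℝ)⁻¹ * (‖f‖ + ‖f‖)) atTop (𝓝 0) := by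
    have := (tendsto_one_div_add_atTop_nhds_zero_nat (𝕜 := ℝ)).mul_const (‖f‖ + ‖f‖)
    simpa using this
  have h0 : ‖φ (f - φ f)‖ ≤ 0 := ge_of_tendsto' hlim hbound
  have := norm_le_zero_iff.1 h0
  rw [map_sub, sub_eq_zero] at this
  exact this.symm

/-- This yields rigidity. From `ψ = ψ ∘ φ` the seminorm of `ψ` is below that of `φ`, so `ψ` is
minimal too, hence idempotent. Then `ψ` kills `φ f - ψ f`; by minimality so does `φ`, which however
fixes this element. -/
theorem eq_of_absorb (hφ : IsMinimalSeminorm D φ) (hψ : ψ ∈ fixingMaps D)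
    (h1 : ∀ f, ψ (φ f) = ψ f) (h2 : ∀ f, φ (ψ f) = ψ f) : ψ = φ := by
  have hle (f) : ‖ψ f‖ ≤ ‖φ f‖ := by
    rw [← h1]
    exact hψ.1.norm_apply_le _
  have hge := hφ.2 ψ hψ hle
  have hmin : IsMinimalSeminorm D ψ :=
    ⟨hψ, fun χ hχ h f => (hle f).trans (hφ.2 χ hχ (fun f => (h f).trans (hle f)) f)⟩
  refine LinearMap.ext fun f => ?_
  have h3 : ψ (φ f - ψ f) = 0 := by rw [map_sub, h1, hmin.idempotent, sub_self]
  have h4 := hge (φ f - ψ f)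
  rw [h3, norm_zero, norm_le_zero_iff, map_sub, hφ.idempotent, h2, sub_eq_zero] at h4
  exact h4.symm

end IsMinimalSeminorm

end fixingMaps

/-! ### The Choi–Effros product and the envelope as the range of a projection. -/

/-- An idempotent equivariant unital positive map of `ℓ^∞(G)` into itself. -/
structure EquivariantProjection (G : Type u) [Group G] [TopologicalSpace G] [DiscreteTopology G]
    where
  /-- the underlying linear map -/
  map : (G →ᵇ ℂ) →ₗ[ℂ] (G →ᵇ ℂ)
  equivariantPositive : IsEquivariantPositive map
  idempotent : ∀ f, map (map f) = map f

namespace EquivariantProjection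

variable {G : Type u} [Group G] [TopologicalSpace G] [DiscreteTopology G]
  (P : EquivariantProjection G)

/-- The key identity of Choi and Effros. -/
theorem map_mul_map (x y : G →ᵇ ℂ) : P.map (P.map x * P.map y) = P.map (x * P.map y) := by
  set b := P.map y with hb
  have hPb : P.map b = b := P.idempotent y
  have key (x : G →ᵇ ℂ) (g : G) : P.map (star (x - P.map x) * b) g = 0 := by
    set p := P.map (star (x - P.map x) * b) g with hp
    have hp' : P.map (star b * (x - P.map x)) g = star p := by
      change _ = star (P.map (star (x - P.map x) * b)) g
      rw [← P.equivariantPositive.map_star (star (x - P.map x) * b), star_mul, star_star]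
    set q := P.map (star x * x - star (P.map x) * P.map x) g with hq
    -- Apply `P` to the Schwarz inequality for `x + t b`. As `P` fixes `b`, the terms in `|t|²`
    -- cancel, and a real-affine function of `t` that is nonnegative everywhere has no linear part.
    have hpos (t : ℂ) : 0 ≤ (q + t * p + star t * star p).re := by
      have h1 := P.equivariantPositive.map_pos _ (P.equivariantPositive.schwarz (x + t • b))
      rw [map_sub, P.idempotent, ← map_sub] at h1
      have h2 := (IsPos.complex_iff.1 (BoundedContinuousFunction.isPos_iff.1 h1 g)).1
      have h3 : star (x + t • b) * (x + t • b) - star (P.map (x + t • b)) * P.map (x + t • b) =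
          (star x * x - star (P.map x) * P.map x) + t • (star (x - P.map x) * b) +
            star t • (star b * (x - P.map x)) := by
        rw [map_add, map_smul, hPb]
        ext h
        simp
        ring
      rw [h3, map_add, map_add, map_smul, map_smul] at h2
      simp only [BoundedContinuousFunction.add_apply, BoundedContinuousFunction.smul_apply,
        smul_eq_mul, hp', ← hp, ← hq] at h2
      exact h2
    by_contra h0
    have hn : 0 < Complex.normSq p := Complex.normSq_pos.2 h0
    -- This `t` gives the expression the value `-1`.
    have h4 := hpos (((-(q.re + 1) / (2 * Complex.normSq p) : ℝ) : ℂ) * star p)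
    have h5 : (((-(q.re + 1) / (2 * Complex.normSq p) : ℝ) : ℂ) * star p) * p =
        ((-(q.re + 1) / 2 : ℝ) : ℂ) := by
      rw [mul_assoc, Complex.star_def, ← Complex.normSq_eq_conj_mul_self, ← Complex.ofReal_mul]
      congr 1
      field_simp
    rw [← star_mul', h5, Complex.star_def, Complex.conj_ofReal, Complex.add_re, Complex.add_re,
      Complex.ofReal_re] at h4
    linarith
  have h : P.map (star (star x - P.map (star x)) * b) = 0 := by
    ext g
    exact key (star x) g
  rw [P.equivariantPositive.map_star, ← star_sub, star_star, sub_mul, map_sub, sub_eq_zero] at h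
  exact h.symm

theorem map_map_mul (x y : G →ᵇ ℂ) : P.map (P.map x * P.map y) = P.map (P.map x * y) := by
  rw [mul_comm, P.map_mul_map, mul_comm]

/-- The range of the projection, with the Choi–Effros product. -/
def Range : Type u := LinearMap.range P.map

instance : NormedAddCommGroup P.Range := inferInstanceAs (NormedAddCommGroup (LinearMap.range P.map))

instance : NormedSpace ℂ P.Range := inferInstanceAs (NormedSpace ℂ (LinearMap.range P.map))

/-- The inclusion of the range. -/
def incl : P.Range →ₗ[ℂ] (G →ᵇ ℂ) := (LinearMap.range P.map).subtype

/-- The projection onto the range. -/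
def proj : (G →ᵇ ℂ) →ₗ[ℂ] P.Range := P.map.rangeRestrict

theorem incl_injective : Function.Injective P.incl := Subtype.val_injective

@[simp] theorem incl_proj (f : G →ᵇ ℂ) : P.incl (P.proj f) = P.map f := rfl

@[simp] theorem map_incl (b : P.Range) : P.map (P.incl b) = P.incl b := by
  obtain ⟨_, f, rfl⟩ := b
  exact P.idempotent f

@[simp] theorem proj_incl (b : P.Range) : P.proj (P.incl b) = b :=
  P.incl_injective (P.map_incl b)

theorem norm_incl (b : P.Range) : ‖P.incl b‖ = ‖b‖ := rfl

instance : CompleteSpace P.Range := by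
  have hc : Continuous P.map :=
    (P.map.mkContinuous 1 fun f => by
      simpa using P.equivariantPositive.norm_apply_le f).continuous
  have : IsClosed (LinearMap.range P.map : Set (G →ᵇ ℂ)) := by
    convert isClosed_eq hc continuous_id using 1
    ext f
    exact ⟨fun ⟨x, hx⟩ => hx ▸ P.idempotent x, fun h => ⟨f, h⟩⟩
  exact this.completeSpace_coe

instance : Mul P.Range := ⟨fun a b => P.proj (P.incl a * P.incl b)⟩

instance : One P.Range := ⟨P.proj 1⟩

instance : Star P.Range := ⟨fun a => P.proj (star (P.incl a))⟩

theorem incl_mul (a b : P.Range) : P.incl (a * b) = P.map (P.incl a * P.incl b) := rfl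

@[simp] theorem incl_one : P.incl 1 = 1 := P.equivariantPositive.map_one

@[simp] theorem incl_star (a : P.Range) : P.incl (star a) = star (P.incl a) := by
  change P.map (star (P.incl a)) = _
  rw [P.equivariantPositive.map_star, map_incl]

instance : NormedCommRing P.Range where
  __ := (inferInstance : NormedAddCommGroup P.Range)
  mul := (· * ·)
  one := 1
  mul_assoc a b c := P.incl_injective <| by
    simp only [incl_mul]
    rw [← P.map_incl c, P.map_mul_map, ← P.map_incl a, P.map_map_mul, mul_assoc]
  one_mul a := P.incl_injective <| by rw [incl_mul, incl_one, one_mul, map_incl]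
  mul_one a := P.incl_injective <| by rw [incl_mul, incl_one, mul_one, map_incl]
  zero_mul a := P.incl_injective <| by rw [incl_mul, map_zero, zero_mul, map_zero]
  mul_zero a := P.incl_injective <| by rw [incl_mul, map_zero, mul_zero, map_zero]
  left_distrib a b c := P.incl_injective <| by
    simp only [incl_mul, map_add, mul_add]
  right_distrib a b c := P.incl_injective <| by
    simp only [incl_mul, map_add, add_mul]
  mul_comm a b := P.incl_injective <| by rw [incl_mul, incl_mul, mul_comm]
  norm_mul_le a b := (P.equivariantPositive.norm_apply_le _).trans (norm_mul_le _ _)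

instance : Algebra ℂ P.Range :=
  Algebra.ofModule
    (fun c a b => P.incl_injective <| by simp only [incl_mul, map_smul, smul_mul_assoc])
    (fun c a b => P.incl_injective <| by simp only [incl_mul, map_smul, mul_smul_comm])

instance : CommCStarAlgebra P.Range where
  norm_smul_le := norm_smul_le
  star_involutive a := P.incl_injective <| by simp
  star_mul a b := P.incl_injective <| by
    rw [incl_star, incl_mul, incl_mul, ← P.equivariantPositive.map_star, star_mul, incl_star,
      incl_star]
  star_add a b := P.incl_injective <| by simp
  star_smul c a := P.incl_injective <| by simp
  norm_mul_self_le a := by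
    -- On the range, Schwarz reads `a* a ≤ P (a* a)`, the nontrivial half of the C*-identity for the
    -- new product.
    have h := P.equivariantPositive.schwarz (P.incl a)
    rw [map_incl] at h
    rw [← norm_incl, ← norm_incl, incl_mul, incl_star, ← CStarRing.norm_star_mul_self]
    exact (IsPos.star_mul_self _).norm_le_norm h

theorem isPos_incl {b : P.Range} : IsPos (P.incl b) ↔ IsPos b := by
  constructor
  · intro h
    refine IsPos.of_norm_sub_le (r := ‖P.incl b‖) (P.incl_injective ?_) ?_
    · rw [incl_star]
      exact h.isSelfAdjoint
    · rw [← norm_incl, map_sub, map_smul, incl_one]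
      exact h.norm_sub_le le_rfl
  · rintro ⟨c, rfl⟩
    rw [incl_mul, incl_star]
    exact P.equivariantPositive.map_pos _ (.star_mul_self _)

theorem isPos_proj {f : G →ᵇ ℂ} (hf : IsPos f) : IsPos (P.proj f) :=
  P.isPos_incl.1 (P.equivariantPositive.map_pos f hf)

theorem translation_incl (g : G) (b : P.Range) :
    P.map (leftTranslation G g (P.incl b)) = leftTranslation G g (P.incl b) := by
  rw [P.equivariantPositive.map_translation, map_incl]

/-- The action of `G` on the range by translations. -/
def action : G →* (P.Range ≃⋆ₐ[ℂ] P.Range) where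
  toFun g :=
    { toFun := fun b => P.proj (leftTranslation G g (P.incl b))
      invFun := fun b => P.proj (leftTranslation G g⁻¹ (P.incl b))
      left_inv := fun b => P.incl_injective <| by
        simp only [incl_proj, translation_incl]
        rw [leftTranslation_inv_apply_self, map_incl]
      right_inv := fun b => P.incl_injective <| by
        simp only [incl_proj, translation_incl]
        rw [leftTranslation_apply_inv_self, map_incl]
      map_mul' := fun a b => P.incl_injective <| by
        simp only [incl_proj, translation_incl, incl_mul, ← P.equivariantPositive.map_translation,
          map_mul, P.idempotent]
      map_add' := fun a b => by simp only [map_add]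
      map_star' := fun a => P.incl_injective <| by
        simp only [incl_proj, incl_star, map_star, P.equivariantPositive.map_star]
      map_smul' := fun c a => by simp only [map_smul] }
  map_one' := by
    ext b
    refine P.incl_injective ?_
    simp
  map_mul' g h := by
    ext b
    refine P.incl_injective ?_
    change P.map (leftTranslation G (g * h) (P.incl b)) =
      P.map (leftTranslation G g (P.map (leftTranslation G h (P.incl b))))
    rw [P.translation_incl h, map_mul]
    rfl

theorem incl_action (g : G) (b : P.Range) :
    P.incl (P.action g b) = leftTranslation G g (P.incl b) :=
  P.translation_incl g b

theorem action_proj (g : G) (f : G →ᵇ ℂ) :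
    P.action g (P.proj f) = P.proj (leftTranslation G g f) :=
  P.incl_injective <| by
    rw [incl_action, incl_proj, incl_proj, P.equivariantPositive.map_translation]

/-- The inclusion of the range, as a map of operator systems. -/
def inclCarrier : (ofCStarAlgebra P.action).carrier →ₗ[ℂ] (boundedFunctions G).carrier :=
  (toCarrier _).toLinearMap ∘ₗ P.incl ∘ₗ (toCarrier _).symm.toLinearMap

/-- The projection onto the range, as a map of operator systems. -/
def projCarrier : (boundedFunctions G).carrier →ₗ[ℂ] (ofCStarAlgebra P.action).carrier :=
  (toCarrier _).toLinearMap ∘ₗ P.proj ∘ₗ (toCarrier _).symm.toLinearMap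

theorem isGMorphism_inclCarrier :
    IsGMorphism (ofCStarAlgebra P.action) (boundedFunctions G) P.inclCarrier :=
  isGMorphism_toCarrier ⟨P.incl_one, fun _ hv => P.isPos_incl.2 hv⟩
    fun g v => P.incl_action g ((toCarrier _).symm v)

theorem isGMorphism_projCarrier :
    IsGMorphism (boundedFunctions G) (ofCStarAlgebra P.action) P.projCarrier :=
  isGMorphism_toCarrier ⟨rfl, fun _ hv => P.isPos_proj hv⟩
    fun g v => (P.action_proj g ((toCarrier _).symm v)).symm

theorem projCarrier_comp_inclCarrier : P.projCarrier ∘ₗ P.inclCarrier = LinearMap.id :=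
  LinearMap.ext fun v => congrArg (toCarrier P.action) (P.proj_incl ((toCarrier P.action).symm v))

theorem isGInjective : IsGInjective (ofCStarAlgebra P.action) :=
  isGInjective_boundedFunctions.of_retract P.isGMorphism_inclCarrier P.isGMorphism_projCarrier
    P.projCarrier_comp_inclCarrier

/-- A `G`-operator system that embeds into `ℓ^∞(G)` has a `G`-injective envelope which is the range
of a projection of `ℓ^∞(G)`. -/
theorem exists_isGInjectiveEnvelope {V : GOperatorSystem G}
    {κ : V.carrier →ₗ[ℂ] (boundedFunctions G).carrier}
    (hκ : IsGEmbedding V (boundedFunctions G) κ) :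
    ∃ P : EquivariantProjection G,
      (∀ v, P.inclCarrier (P.projCarrier (κ v)) = κ v) ∧
        IsGInjectiveEnvelope V (ofCStarAlgebra P.action) (P.projCarrier ∘ₗ κ) := by
  obtain ⟨φ, hφ⟩ := fixingMaps.exists_isMinimalSeminorm
    (Set.range fun v => (toCarrier (leftTranslation G)).symm (κ v))
  let P : EquivariantProjection G := ⟨φ, hφ.1.1, hφ.idempotent⟩
  have hfix (v) : P.inclCarrier (P.projCarrier (κ v)) = κ v :=
    (toCarrier _).symm.injective (hφ.1.2 _ ⟨v, rfl⟩)
  refine ⟨P, hfix, isGInjectiveEnvelope_of_rigid ?_ P.isGInjective fun β hβ hβκ => ?_⟩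
  · refine (P.isGMorphism_projCarrier.comp hκ.isGMorphism).isGEmbedding_of_comp
      P.isGMorphism_inclCarrier ?_
    rwa [show P.inclCarrier ∘ₗ P.projCarrier ∘ₗ κ = κ from LinearMap.ext hfix]
  -- Transported to `ℓ^∞(G)`, the endomorphism `β` becomes a fixing map absorbed by `φ` on both
  -- sides, so it equals `φ`, and `β` is the identity.
  let β' : P.Range →ₗ[ℂ] P.Range :=
    (toCarrier P.action).symm.toLinearMap ∘ₗ β ∘ₗ (toCarrier P.action).toLinearMap
  have hβ' : P.incl ∘ₗ β' ∘ₗ P.proj = φ := by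
    refine hφ.eq_of_absorb ⟨⟨?_, fun f hf => ?_, fun g f => ?_⟩, ?_⟩ (fun f => ?_) fun f => ?_
    · exact (congrArg (fun v => P.incl ((toCarrier P.action).symm v)) hβ.1.1).trans P.incl_one
    · exact P.isPos_incl.2 (hβ.1.isPos (v := toCarrier P.action (P.proj f)) (P.isPos_proj hf))
    · have h := hβ.2 g (toCarrier P.action (P.proj f))
      rw [ρ_toCarrier, action_proj] at h
      have h2 := congrArg (fun v => P.incl ((toCarrier P.action).symm v)) h
      exact h2.trans (P.incl_action g _)
    · rintro _ ⟨v, rfl⟩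
      have h := congrArg (fun v => (toCarrier (leftTranslation G)).symm (P.inclCarrier v))
        (LinearMap.congr_fun hβκ v)
      exact h.trans (congrArg _ (hfix v))
    · have h : P.proj (φ f) = P.proj f := P.incl_injective (hφ.idempotent f)
      simp only [LinearMap.comp_apply, h]
    · exact P.map_incl _
  refine LinearMap.ext fun v => (toCarrier P.action).symm.injective (P.incl_injective ?_)
  have h := LinearMap.congr_fun hβ' (P.incl ((toCarrier P.action).symm v))
  simp only [LinearMap.comp_apply, P.proj_incl] at h
  exact h.trans (P.map_incl _)

end EquivariantProjection

/-! ### Characters, their orbits and the map into `C(L)`. -/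

namespace ContinuousMap

variable {X : Type*} [TopologicalSpace X] [CompactSpace X]

theorem isPos_iff {f : C(X, ℂ)} : IsPos f ↔ ∀ x, IsPos (f x) := by
  refine ⟨fun ⟨b, hb⟩ x => ⟨b x, by rw [hb]; rfl⟩, fun h => ?_⟩
  refine ⟨⟨fun x => (√(f x).re : ℂ), by fun_prop⟩, ?_⟩
  ext x
  obtain ⟨h1, h2⟩ := IsPos.complex_iff.1 (h x)
  change f x = star ((√(f x).re : ℝ) : ℂ) * ((√(f x).re : ℝ) : ℂ)
  rw [Complex.star_def, Complex.conj_ofReal, ← Complex.ofReal_mul, Real.mul_self_sqrt h1]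
  exact Complex.ext rfl h2

end ContinuousMap

section Characters

open WeakDual

variable {G : Type u} [Group G] {B : Type u} [CommCStarAlgebra B]

/-- A character of a C*-algebra as a state on its operator system. -/
def characterState (α : G →* (B ≃⋆ₐ[ℂ] B)) (χ : characterSpace ℂ B) :
    (ofCStarAlgebra α).carrier →ₗ[ℂ] ℂ :=
  (CharacterSpace.toAlgHom χ).toLinearMap ∘ₗ (toCarrier α).symm.toLinearMap

theorem isPosUnital_characterState (α : G →* (B ≃⋆ₐ[ℂ] B)) (χ : characterSpace ℂ B) :
    IsPosUnital (S := (ofCStarAlgebra α).toOperatorSystem) (characterState α χ) :=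
  ⟨map_one χ, fun _ hv => IsPos.map χ hv⟩

/-- The Poisson map of a character. -/
def characterPoisson [TopologicalSpace G] [DiscreteTopology G] (α : G →* (B ≃⋆ₐ[ℂ] B))
    (χ : characterSpace ℂ B) : B →ₐ[ℂ] (G →ᵇ ℂ) :=
  AlgHom.ofLinearMap
    (poisson (characterState α χ) (isPosUnital_characterState α χ) ∘ₗ (toCarrier α).toLinearMap)
    (isPosUnital_poisson _ (isPosUnital_characterState α χ)).1 fun a b => by
      ext g
      change χ (α g⁻¹ (a * b)) = χ (α g⁻¹ a) * χ (α g⁻¹ b)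
      rw [map_mul, map_mul]

theorem characterPoisson_apply [TopologicalSpace G] [DiscreteTopology G] (α : G →* (B ≃⋆ₐ[ℂ] B))
    (χ : characterSpace ℂ B) (b : B) (g : G) : characterPoisson α χ b g = χ (α g⁻¹ b) := rfl

/-- The Poisson map of a character, as a map of operator systems. -/
def characterPoissonCarrier [TopologicalSpace G] [DiscreteTopology G] (α : G →* (B ≃⋆ₐ[ℂ] B))
    (χ : characterSpace ℂ B) : (ofCStarAlgebra α).carrier →ₗ[ℂ] (boundedFunctions G).carrier :=
  (toCarrier _).toLinearMap ∘ₗ poisson (characterState α χ) (isPosUnital_characterState α χ)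

/-- For a minimal `G`-space `X`, the Poisson maps of the characters of `C(X)` are embeddings. -/
theorem isGEmbedding_characterPoisson [TopologicalSpace G] [DiscreteTopology G] {X : Type u}
    [TopologicalSpace X] [CompactSpace X] [T2Space X] [MulAction G X] [ContinuousConstSMul G X]
    [MulAction.IsMinimal G X] (χ : characterSpace ℂ C(X, ℂ)) :
    IsGEmbedding (continuousFunctions G X) (boundedFunctions G)
      (characterPoissonCarrier (translationAction G X) χ) := by
  -- Characters of `C(X)` are point evaluations, so the Poisson map samples `f` along the dense
  -- orbit of `x`.
  obtain ⟨x, rfl⟩ := (CharacterSpace.continuousMapEval_bijective (X := X) (𝕜 := ℂ)).2 χ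
  have hmor := isGMorphism_poisson (W := continuousFunctions G X) _
    (isPosUnital_characterState (translationAction G X)
      (CharacterSpace.continuousMapEval X ℂ x))
  refine ⟨isCompleteOrderEmbedding_of_isPos_iff
    (S := (continuousFunctions G X).toOperatorSystem) (T := (boundedFunctions G).toOperatorSystem)
    (fun a b : C(X, ℂ) => mul_comm a b) (fun a b : G →ᵇ ℂ => mul_comm a b) hmor.1.1
    fun v => ⟨fun h => ?_, hmor.1.isPos⟩, hmor.2⟩
  obtain ⟨f, rfl⟩ := (toCarrier (translationAction G X)).surjective v
  have h1 (g : G) : IsPos (f (g • x)) := by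
    have h2 : IsPos (f (g⁻¹⁻¹ • x)) := BoundedContinuousFunction.isPos_iff.1 h g
    rwa [inv_inv] at h2
  refine ContinuousMap.isPos_iff.2 fun y => ?_
  have hcl : IsClosed {y | IsPos (f y)} := by
    simp only [IsPos.complex_iff, Set.ofPred_and]
    exact (isClosed_le continuous_const (Complex.continuous_re.comp f.continuous)).inter
      (isClosed_eq (Complex.continuous_im.comp f.continuous) continuous_const)
  have hsub : MulAction.orbit G x ⊆ {y | IsPos (f y)} := by
    rintro _ ⟨g, rfl⟩
    exact h1 g
  exact hcl.closure_subset_iff.2 hsub (MulAction.IsMinimal.dense_orbit x y)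

/-- The translates `b ↦ χ (g⁻¹ b)` of a character. -/
def translateCharacter (α : G →* (B ≃⋆ₐ[ℂ] B)) (χ : characterSpace ℂ B) (g : G) :
    characterSpace ℂ B :=
  CharacterSpace.equivAlgHom.symm
    ((CharacterSpace.toAlgHom χ).comp (AlgHomClass.toAlgHom (α g⁻¹)))

theorem translateCharacter_apply (α : G →* (B ≃⋆ₐ[ℂ] B)) (χ : characterSpace ℂ B) (g : G) (b : B) :
    translateCharacter α χ g b = χ (α g⁻¹ b) := rfl

/-- The continuous extension to `βG` of the orbit map `g ↦ g χ` of a character. -/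
def orbitExtension (α : G →* (B ≃⋆ₐ[ℂ] B)) (χ : characterSpace ℂ B) :
    C(Ultrafilter G, characterSpace ℂ B) :=
  ⟨Ultrafilter.extend (translateCharacter α χ), continuous_ultrafilter_extend _⟩

theorem orbitExtension_pure (α : G →* (B ≃⋆ₐ[ℂ] B)) (χ : characterSpace ℂ B) (g : G) :
    orbitExtension α χ (pure g) = translateCharacter α χ g :=
  ultrafilter_extend_pure _ g

attribute [local instance] Ultrafilter.semigroup

/-- Both sides are continuous in `u` and agree on principal ultrafilters, which are dense. -/
theorem orbitExtension_apply_map (α : G →* (B ≃⋆ₐ[ℂ] B)) (χ : characterSpace ℂ B) (g : G) (b : B)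
    (u : Ultrafilter G) :
    orbitExtension α χ u (α g b) = orbitExtension α χ ((pure g⁻¹ : Ultrafilter G) * u) b := by
  have hev (b : B) : Continuous fun χ : characterSpace ℂ B => χ b :=
    (gelfandTransform ℂ B b).continuous
  refine congrFun (denseRange_pure.equalizer ((hev (α g b)).comp (orbitExtension α χ).continuous)
    ((hev b).comp ((orbitExtension α χ).continuous.comp (continuous_pure_mul g⁻¹))) ?_) u
  funext h
  have hm : (pure g⁻¹ : Ultrafilter G) * pure h = pure (g⁻¹ * h) := rfl
  simp only [Function.comp_apply, hm, orbitExtension_pure, translateCharacter_apply, mul_inv_rev,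
    inv_inv, map_mul]
  rfl

/-- The *-homomorphism into `C(L)` given by the orbit of a character. -/
def characterOrbitHom (α : G →* (B ≃⋆ₐ[ℂ] B)) (χ : characterSpace ℂ B) (L : Set (Ultrafilter G)) :
    B →⋆ₐ[ℂ] C(L, ℂ) :=
  (ContinuousMap.compStarAlgHom' ℂ ℂ
    ((orbitExtension α χ).comp ⟨Subtype.val, continuous_subtype_val⟩)).comp
    (gelfandStarTransform B : B →⋆ₐ[ℂ] C(characterSpace ℂ B, ℂ))

theorem characterOrbitHom_apply (α : G →* (B ≃⋆ₐ[ℂ] B)) (χ : characterSpace ℂ B)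
    {L : Set (Ultrafilter G)} (b : B) (v : L) :
    characterOrbitHom α χ L b v = orbitExtension α χ v b := rfl

theorem characterOrbitHom_map (α : G →* (B ≃⋆ₐ[ℂ] B)) (χ : characterSpace ℂ B)
    {L : Set (Ultrafilter G)} (hL : IsLeftIdeal L) (g : G) (b : B) :
    characterOrbitHom α χ L (α g b) =
      (characterOrbitHom α χ L b).comp (leftIdealTranslation hL g⁻¹) :=
  ContinuousMap.ext fun v => orbitExtension_apply_map α χ g b v

/-- If the Poisson maps of all characters are injective, then so is the map into `C(L)`. -/
theorem characterOrbitHom_injective [TopologicalSpace G] [DiscreteTopology G]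
    (α : G →* (B ≃⋆ₐ[ℂ] B))
    (h : ∀ χ : characterSpace ℂ B, Function.Injective (characterPoisson α χ))
    (χ : characterSpace ℂ B) {L : Set (Ultrafilter G)} (hL : IsLeftIdeal L) :
    Function.Injective (characterOrbitHom α χ L) := by
  obtain ⟨v, hv⟩ := hL.1
  refine (injective_iff_map_eq_zero _).2 fun b hb => ?_
  -- The translates of the character at `v` are the values of the extension at `g v`, which lie over
  -- `L`; so the Poisson map of this character kills `b`.
  refine (injective_iff_map_eq_zero _).1 (h (orbitExtension α χ v)) b ?_
  ext g
  rw [characterPoisson_apply, orbitExtension_apply_map, inv_inv]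
  have h2 := DFunLike.congr_fun hb (⟨(pure g : Ultrafilter G) * v, hL.2 _ v hv⟩ : L)
  rw [characterOrbitHom_apply] at h2
  exact h2

end Characters

/-! ### The main theorem. -/

theorem theorem4p3 {G : Type u} [Group G] {X : Type u} [TopologicalSpace X] [CompactSpace X]
    [T2Space X] [Nonempty X] [MulAction G X] [ContinuousConstSMul G X] [MulAction.IsMinimal G X]
    {L : Set (Ultrafilter G)} (hL : IsMinimalLeftIdeal L) :
    (∃ (E : GOperatorSystem G) (κ : (continuousFunctions G X).carrier →ₗ[ℂ] E.carrier),
      GOperatorSystem.IsGInjectiveEnvelope (continuousFunctions G X) E κ) ∧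
    ∀ (E : GOperatorSystem G) (κ : (continuousFunctions G X).carrier →ₗ[ℂ] E.carrier),
      GOperatorSystem.IsGInjectiveEnvelope (continuousFunctions G X) E κ →
      ∃ (B : Type u) (_ : CStarAlgebra B) (α : G →* (B ≃⋆ₐ[ℂ] B))
        (θ : E.carrier ≃ₗ[ℂ] (GOperatorSystem.ofCStarAlgebra α).carrier),
        GOperatorSystem.IsGEmbedding E (GOperatorSystem.ofCStarAlgebra α) θ.toLinearMap ∧
        ∃ π : B →⋆ₐ[ℂ] C(L, ℂ), Function.Injective π ∧
          ∀ (g : G) (b : B), π (α g b) = (π b).comp (leftIdealTranslation hL.prop g⁻¹) := by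
  let _ : TopologicalSpace G := ⊥
  have : DiscreteTopology G := ⟨rfl⟩
  obtain ⟨x₀⟩ := ‹Nonempty X›
  let χ₀ := WeakDual.CharacterSpace.continuousMapEval X ℂ x₀
  obtain ⟨P, hP, hE⟩ := EquivariantProjection.exists_isGInjectiveEnvelope
    (isGEmbedding_characterPoisson (G := G) χ₀)
  refine ⟨⟨_, _, hE⟩, fun E κ hκ => ?_⟩
  obtain ⟨θ, hθ, -⟩ := hκ.exists_equiv hE
  have : Nontrivial P.Range := ⟨1, 0, fun h => by
    have := congrArg P.incl h
    rw [P.incl_one, map_zero] at this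
    exact one_ne_zero (α := ℂ) (DFunLike.congr_fun this 1)⟩
  obtain ⟨χ⟩ : Nonempty (WeakDual.characterSpace ℂ P.Range) := inferInstance
  have hfix (f : C(X, ℂ)) : P.map (characterPoisson (translationAction G X) χ₀ f) =
      characterPoisson (translationAction G X) χ₀ f :=
    congrArg (toCarrier (leftTranslation G)).symm (hP (toCarrier (translationAction G X) f))
  -- The image of `C(X)` is closed under the pointwise product and fixed by `P`, so on it the
  -- Choi–Effros product is the pointwise one and `k` is multiplicative.
  let k : C(X, ℂ) →ₐ[ℂ] P.Range := AlgHom.ofLinearMap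
    (P.proj ∘ₗ (characterPoisson (translationAction G X) χ₀).toLinearMap)
    (by simp; rfl) fun a b => P.incl_injective <| by
      simp [EquivariantProjection.incl_mul, hfix]
  refine ⟨P.Range, inferInstance, P.action, θ, hθ, characterOrbitHom P.action χ L,
    characterOrbitHom_injective P.action (fun χ' => ?_) χ hL.prop,
    characterOrbitHom_map P.action χ hL.prop⟩
  let ξ : WeakDual.characterSpace ℂ C(X, ℂ) := WeakDual.CharacterSpace.equivAlgHom.symm
    ((WeakDual.CharacterSpace.toAlgHom χ').comp k)
  have hcomp : characterPoissonCarrier P.action χ' ∘ₗ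
      P.projCarrier ∘ₗ characterPoissonCarrier (translationAction G X) χ₀ =
        characterPoissonCarrier (translationAction G X) ξ := by
    refine LinearMap.ext fun v => (toCarrier (leftTranslation G)).symm.injective ?_
    obtain ⟨f, rfl⟩ := (toCarrier (translationAction G X)).surjective v
    ext g
    change χ' (P.action g⁻¹ (k f)) = χ' (k (translationAction G X g⁻¹ f))
    congr 1
    refine (P.action_proj g⁻¹ _).trans (congrArg P.proj ?_)
    exact (poisson_ρ _ (isPosUnital_characterState (translationAction G X) χ₀) g⁻¹
      (toCarrier (translationAction G X) f)).symm
  -- Essentiality: restricted to `C(X)`, the Poisson map of `χ'` is that of the character `ξ = χ' ∘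
  -- k`, which is an embedding by minimality of `X`.
  have hemb : IsGEmbedding _ _ (characterPoissonCarrier P.action χ') := by
    refine hE.2.2.1 _ _ (isGMorphism_poisson _ (isPosUnital_characterState P.action χ')) ?_
    have h := isGEmbedding_characterPoisson (G := G) ξ
    rw [← hcomp] at h
    exact h
  exact fun a b h => (toCarrier P.action).injective
    (hemb.1.injective (congrArg (toCarrier (leftTranslation G)) h))

end
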